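/- Let $A$ be a finite-dimensional algebra over a field $K$, and let $\mathrm{mod}(A)$ be the category of finitely generated left $A$-modules. Write $D=\mathrm{Hom}_K(-,K)$, $\Omega$ for the syzygy (kernel of a projective cover) and $\Omega^{-1}$ for the cosyzygy (cokernel of an injective envelope), $\tau=D\,\mathrm{Tr}$ and $\tau^-=\mathrm{Tr}\,D$ for the Auslander--Reiten translations, $\tau_2=\tau\Omega$ and $\tau_2^-=\tau^-\Omega^{-1}$. For $M\in\mathrm{mod}(A)$ let $\mathrm{add}(M)$ be the full subcategory of all modules isomorphic to direct summands of finite direct sums of copies of $M$. The module $M$ is called $2$-precluster tilting if (P1) $M$ is a generator-cogenerator, i.e. $A\in\mathrm{add}(M)$ and $DA\in\mathrm{add}(M)$; (P2) $\tau_2M\in\mathrm{add}(M)$ and $\tau_2^-M\in\mathrm{add}(M)$; (P3) $\mathrm{Ext}^1_A(M,M)=0$; and a $2$-precluster-tilting subcategory of $\mathrm{mod}(A)$ is a subcategory of the form $\mathrm{add}(M)$ for a $2$-precluster-tilting module $M$. **Theorem 1.1.** Let $e\in A$ be an idempotent, let $\langle e\rangle=AeA$, and regard $\mathrm{mod}(A/\langle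 e\rangle)$ as a full subcategory of $\mathrm{mod}(A)$ by restriction along $A\to A/\langle e\rangle$. Let $\tilde{\mathcal C}\subseteq\mathrm{mod}(A)$ be a $2$-precluster-tilting subcategory such that (i) $\mathrm{Hom}_A(A/\langle e\rangle,X)\in\tilde{\mathcal C}$ for every $X\in\tilde{\mathcal C}$; (ii) $A/\langle e\rangle\otimes_A X\in\tilde{\mathcal C}$ for every $X\in\tilde{\mathcal C}$. Then $\mathcal C:=\tilde{\mathcal C}\cap\mathrm{mod}(A/\langle e\rangle)$ is a $2$-precluster-tilting subcategory of $\mathrm{mod}(A/\langle e\rangle)$. -/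

import Mathlib

open CategoryTheory
open scoped TensorProduct ModuleCat

universe u

namespace Precluster

/-! ### Syzygies, cosyzygies and the transpose (over an arbitrary ring `R`) -/

section Ring

variable {R : Type u} [Ring R]

/-- A surjective map `p : P → M` from a finitely generated projective module whose kernel is
superfluous (small) in `P`. -/
structure IsProjectiveCover {P M : Type u} [AddCommGroup P] [Module R P]
    [AddCommGroup M] [Module R M] (p : P →ₗ[R] M) : Prop where
  finite : Module.Finite R P
  projective : Module.Projective R P
  surjective : Function.Surjective p
  superfluous : ∀ L : Submodule R P, L ⊔ LinearMap.ker p = ⊤ → L = ⊤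

/-- An injective map `j : N → I` into a finitely generated injective module whose image is
essential (large) in `I`. -/
structure IsInjectiveEnvelope {N I : Type u} [AddCommGroup N] [Module R N]
    [AddCommGroup I] [Module R I] (j : N →ₗ[R] I) : Prop where
  finite : Module.Finite R I
  isInjective : Module.Injective.{u, u} R I
  injective : Function.Injective j
  essential : ∀ L : Submodule R I, L ⊓ LinearMap.range j = ⊥ → L = ⊥

/-- `L ≅ Ω M`: the kernel of a projective cover of `M`. -/
def IsSyzygy (M L : ModuleCat.{u} R) : Prop :=
  ∃ (P : ModuleCat.{u} R) (p : P →ₗ[R] M),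
    IsProjectiveCover p ∧ Nonempty (L ≃ₗ[R] LinearMap.ker p)

/-- `L ≅ Ω⁻¹ N`: the cokernel of an injective envelope of `N`. -/
def IsCosyzygy (N L : ModuleCat.{u} R) : Prop :=
  ∃ (I : ModuleCat.{u} R) (j : N →ₗ[R] I),
    IsInjectiveEnvelope j ∧ Nonempty (L ≃ₗ[R] (I ⧸ LinearMap.range j))

/-- `L ≅ Ωⁿ M`. -/
def IsNthSyzygy : ℕ → ModuleCat.{u} R → ModuleCat.{u} R → Prop
  | 0, M, L => Nonempty (L ≃ₗ[R] M)
  | n + 1, M, L => ∃ L', IsNthSyzygy n M L' ∧ IsSyzygy L' L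

/-- `L ≅ Ω⁻ⁿ N`. -/
def IsNthCosyzygy : ℕ → ModuleCat.{u} R → ModuleCat.{u} R → Prop
  | 0, N, L => Nonempty (L ≃ₗ[R] N)
  | n + 1, N, L => ∃ L', IsNthCosyzygy n N L' ∧ IsCosyzygy L' L

/-- `T ≅ Tr M`: for a minimal projective presentation `P₁ → P₀ → M → 0`, the right module `T` is
the cokernel of `Hom_R(P₀, R) → Hom_R(P₁, R)`.  Right `R`-modules are left `Rᵐᵒᵖ`-modules; here
`Rᵐᵒᵖ` acts on `Hom_R(P, R)` through right multiplication on the values. -/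
def IsTranspose (M : ModuleCat.{u} R) (T : ModuleCat.{u} Rᵐᵒᵖ) : Prop :=
  ∃ (P₁ P₀ : ModuleCat.{u} R) (p : P₀ →ₗ[R] M) (q : P₁ →ₗ[R] LinearMap.ker p),
    IsProjectiveCover p ∧ IsProjectiveCover q ∧
      Nonempty (T ≃ₗ[Rᵐᵒᵖ] ((P₁ →ₗ[R] R) ⧸
        LinearMap.range (LinearMap.lcomp Rᵐᵒᵖ R ((LinearMap.ker p).subtype ∘ₗ q))))

/-- `add M`: the modules isomorphic to direct summands of finite direct sums of copies of `M`. -/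
def addClosure (M : ModuleCat.{u} R) : ObjectProperty (ModuleCat.{u} R) := fun X =>
  ∃ (n : ℕ) (Y : ModuleCat.{u} R), Nonempty ((X × Y) ≃ₗ[R] (Fin n → M))

/-- A right `R`-module that is presented as an `(Rᵐᵒᵖ)ᵐᵒᵖ`-module, seen as a left `R`-module. -/
noncomputable def ofOpOp (N : ModuleCat.{u} Rᵐᵒᵖᵐᵒᵖ) : ModuleCat.{u} R :=
  (ModuleCat.restrictScalars (RingEquiv.opOp R).toRingHom).obj N

end Ring

/-! ### The duality `D = Hom_K(-, K)` -/

section Dual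

variable (K : Type u) [Field K] {R : Type u} [Ring R] [Algebra K R]

/-- The underlying space `Hom_K(N, K)` of `D N`. -/
def DualSpace (N : ModuleCat.{u} R) : Type u := N →ₗ[K] K

noncomputable instance (N : ModuleCat.{u} R) : AddCommGroup (DualSpace K N) :=
  inferInstanceAs (AddCommGroup (N →ₗ[K] K))

/-- The opposite ring acts on `Hom_K(N, K)` by `(r • f) x = f (r • x)`. -/
noncomputable instance (N : ModuleCat.{u} R) : Module Rᵐᵒᵖ (DualSpace K N) where
  smul r f := LinearMap.comp (M₂ := N) f (Algebra.lsmul K K N r.unop)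
  one_smul (f : N →ₗ[K] K) := LinearMap.ext fun x => congrArg f (one_smul R x)
  mul_smul r s (f : N →ₗ[K] K) := LinearMap.ext fun x => congrArg f (mul_smul s.unop r.unop x)
  smul_zero _ := rfl
  smul_add _ _ _ := rfl
  add_smul r s (f : N →ₗ[K] K) := LinearMap.ext fun x =>
    (congrArg f (add_smul r.unop s.unop x)).trans (f.map_add _ _)
  zero_smul (f : N →ₗ[K] K) := LinearMap.ext fun x =>
    (congrArg f (zero_smul R x)).trans f.map_zero

/-- `D N = Hom_K(N, K)`, a module over the opposite algebra. -/
noncomputable def dual (N : ModuleCat.{u} R) : ModuleCat.{u} Rᵐᵒᵖ :=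
  ModuleCat.of Rᵐᵒᵖ (DualSpace K N)

/-- The left module `DR`, the dual of the right regular module. -/
noncomputable def dualRegular (R : Type u) [Ring R] [Algebra K R] : ModuleCat.{u} R :=
  ofOpOp (dual K (ModuleCat.of Rᵐᵒᵖ R))

/-- `T ≅ τ_d M`, where `τ_d = τ Ω^(d-1)` and `τ = D Tr`. -/
def IsTau (d : ℕ) (M T : ModuleCat.{u} R) : Prop :=
  ∃ (L : ModuleCat.{u} R) (U : ModuleCat.{u} Rᵐᵒᵖ),
    IsNthSyzygy (d - 1) M L ∧ IsTranspose L U ∧ Nonempty (T ≃ₗ[R] ofOpOp (dual K U))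

/-- `T ≅ τ_d⁻ N`, where `τ_d⁻ = τ⁻ Ω^(-(d-1))` and `τ⁻ = Tr D`. -/
def IsTauInv (d : ℕ) (N T : ModuleCat.{u} R) : Prop :=
  ∃ (L : ModuleCat.{u} R) (U : ModuleCat.{u} Rᵐᵒᵖᵐᵒᵖ),
    IsNthCosyzygy (d - 1) N L ∧ IsTranspose (dual K L) U ∧ Nonempty (T ≃ₗ[R] ofOpOp U)

/-- `d`-precluster-tilting modules over the `K`-algebra `R`.  Minimal presentations are unique up
to isomorphism, so `τ_d M` and `τ_d⁻ M` are defined up to isomorphism; the conditions on them say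
that they exist and lie in `add M`. -/
structure IsPreclusterTilting (d : ℕ) (M : ModuleCat.{u} R) : Prop where
  finite : Module.Finite R M
  generator : addClosure M (ModuleCat.of R R)
  cogenerator : addClosure M (dualRegular K R)
  exists_tau : ∃ T, IsTau K d M T
  tau_mem : ∀ T, IsTau K d M T → addClosure M T
  exists_tauInv : ∃ T, IsTauInv K d M T
  tauInv_mem : ∀ T, IsTauInv K d M T → addClosure M T
  ext_eq_zero : ∀ i, 0 < i → i < d → Subsingleton (Abelian.Ext M M i)

/-- A `d`-precluster-tilting subcategory is one of the form `add M` with `M` a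
`d`-precluster-tilting module. -/
def IsPreclusterTiltingSubcategory (d : ℕ) (C : ObjectProperty (ModuleCat.{u} R)) : Prop :=
  ∃ M : ModuleCat.{u} R, IsPreclusterTilting K d M ∧ C = addClosure M

end Dual

/-! ### The quotient by an idempotent -/

section Quotient

/-- For a ring homomorphism `f : R → S` and a left `R`-module `X`, the left `S`-module
`S ⊗_R X`: the quotient of `S ⊗_ℤ X` by the relations `s f(r) ⊗ x = s ⊗ r x`. -/
noncomputable def tensorObj {R S : Type u} [Ring R] [Ring S] (f : R →+* S)
    (X : ModuleCat.{u} R) : ModuleCat.{u} S :=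
  ModuleCat.of S ((S ⊗[ℤ] X) ⧸ Submodule.span S
    {t : S ⊗[ℤ] X | ∃ (s : S) (r : R) (x : X), t = (s * f r) ⊗ₜ[ℤ] x - s ⊗ₜ[ℤ] (r • x)})

variable {A : Type u} [Ring A] (e : A)

/-- The two-sided ideal `⟨e⟩ = AeA`. -/
abbrev idealOf : Ideal A := (TwoSidedIdeal.span {e}).asIdeal

/-- The algebra `A/⟨e⟩`. -/
abbrev QuotAlg : Type u := A ⧸ idealOf e

/-- Inclusion `mod(A/⟨e⟩) ⊆ mod(A)`, by restriction along `A → A/⟨e⟩`. -/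
noncomputable abbrev inclusion : ModuleCat.{u} (QuotAlg e) ⥤ ModuleCat.{u} A :=
  ModuleCat.restrictScalars (Ideal.Quotient.mk (idealOf e))

/-- `Hom_A(A/⟨e⟩, X)` as an `A`-module. -/
noncomputable def homQuot (X : ModuleCat.{u} A) : ModuleCat.{u} A :=
  (inclusion e).obj ((ModuleCat.coextendScalars (Ideal.Quotient.mk (idealOf e))).obj X)

/-- `A/⟨e⟩ ⊗_A X` as an `A`-module. -/
noncomputable def tensorQuot (X : ModuleCat.{u} A) : ModuleCat.{u} A :=
  (inclusion e).obj (tensorObj (Ideal.Quotient.mk (idealOf e)) X)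

end Quotient

end Precluster

/-!
The argument is carried out for a surjective homomorphism `f : R → S` of finite-dimensional algebras
with kernel `I`, in place of `A → A/⟨e⟩`, and for a `2`-precluster tilting `R`-module `M` such that
`S ⊗ -` and `Hom_R(S, -)` preserve `add M`.

*The additive closure.*  An `S`-module `X` in `add M` satisfies `X = S ⊗ X ∈ add (S ⊗ M)`, and
`S ⊗ M ∈ add M` by assumption.  Hence the `S`-modules in `add M` form `add (S ⊗ M)`
(`IsReduction.inAdd`), and likewise `add Hom_R(S, M)` (`IsCoreduction.inAdd`).  The generator
`S = S ⊗ R` and the cogenerator `DS = Hom_R(S, DR)` lie in it.  An extension of `S`-modules that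
splits over `R` splits over `S`, so `Ext¹_S` vanishes on it as well.

*The translate.*  Let `Q₂ → Q₁ → Q₀ → M → 0` be the beginning of a minimal projective resolution.
Since `DS ∈ add M`, one has `D Tor₁(S, M) = Ext¹_R(M, DS) = 0`, so the reduction `S ⊗ Q` still is the
beginning of a projective resolution of `S ⊗ M`, though perhaps not a minimal one
(`mem_smul_ker_of_forall_extend`, `IsPres.exists_reduction`).  As `Hom_S(S ⊗ Q, S)` is the reduction
of `Hom_R(Q, R)` for `Q` finitely generated projective, the cokernel of
`Hom_S(S ⊗ Q₁, S) → Hom_S(S ⊗ Q₂, S)` is the reduction of `Tr Ω M`.  For any `X ∈ add (S ⊗ M)` the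
module `Tr Ω X` over `S` is in the additive closure of this cokernel (`IsMinPres.inAdd_trCoker`).
Dualizing, `τ₂ X ∈ add Hom_R(S, τ₂ M)`, which is contained in `add M` because `τ₂ M ∈ add M` and
`Hom_R(S, -)` preserves `add M`.

*The inverse translate.*  Since `τ₂⁻ X` is `Tr Ω (D X)`, the same argument applies to `D M` over the
opposite algebras, where the reduction of `D M` is `D Hom_R(S, M)`.  The vanishing of `Tor₁` now
follows from `Ext¹_R(S, M) = 0` (`mem_smul_ker_dualMap`).

The existence of `τ₂` and `τ₂⁻` over `S` amounts to that of projective covers and injective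
envelopes, which follows from Fitting's lemma.
-/

namespace Precluster

/-! ### Additive closures -/

/-- `X` lies in `add Y`, expressed without choosing a complement: the identity of `X` is a finite
sum of endomorphisms that factor through `Y`.  In this form every additive functor visibly
preserves the relation. -/
def InAdd (R : Type*) [Ring R] (X Y : Type*) [AddCommGroup X] [Module R X]
    [AddCommGroup Y] [Module R Y] : Prop :=
  ∃ (n : ℕ) (a : Fin n → X →ₗ[R] Y) (b : Fin n → Y →ₗ[R] X), ∀ x, ∑ i, b i (a i x) = x

section InAdd

variable {R : Type*} [Ring R] {X Y Z : Type*} [AddCommGroup X] [Module R X]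
  [AddCommGroup Y] [Module R Y] [AddCommGroup Z] [Module R Z]

theorem InAdd.of_fintype {ι : Type*} [Fintype ι] (a : ι → X →ₗ[R] Y) (b : ι → Y →ₗ[R] X)
    (h : ∀ x, ∑ i, b i (a i x) = x) : InAdd R X Y := by
  let e := (Fintype.equivFin ι).symm
  refine ⟨Fintype.card ι, fun i => a (e i), fun i => b (e i), fun x => ?_⟩
  rw [e.sum_comp (fun i => b i (a i x)), h]

theorem InAdd.trans (h₁ : InAdd R X Y) (h₂ : InAdd R Y Z) : InAdd R X Z := by
  obtain ⟨n, a, b, h⟩ := h₁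
  obtain ⟨m, c, d, h'⟩ := h₂
  refine InAdd.of_fintype (ι := Fin n × Fin m) (fun i => c i.2 ∘ₗ a i.1)
    (fun i => b i.1 ∘ₗ d i.2) fun x => ?_
  simp only [Fintype.sum_prod_type, LinearMap.comp_apply, ← map_sum, h', h]

theorem InAdd.of_leftInverse (a : X →ₗ[R] Y) (b : Y →ₗ[R] X) (h : ∀ x, b (a x) = x) :
    InAdd R X Y :=
  InAdd.of_fintype (ι := Unit) (fun _ => a) (fun _ => b) (by simpa using h)

theorem InAdd.of_equiv (e : X ≃ₗ[R] Y) : InAdd R X Y :=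
  InAdd.of_leftInverse e.toLinearMap e.symm.toLinearMap (by simp)

theorem InAdd.of_bijective {n : ℕ} (a : Fin n → X →ₗ[R] Y) (b : Fin n → Y →ₗ[R] X)
    (h : Function.Bijective (fun x => ∑ i, b i (a i x))) : InAdd R X Y := by
  let θ : X →ₗ[R] X := ∑ i, b i ∘ₗ a i
  have hθ : ∀ x, θ x = ∑ i, b i (a i x) := by simp [θ]
  let e := LinearEquiv.ofBijective θ (by convert h using 1; ext x; exact hθ x)
  refine ⟨n, a, fun i => e.symm.toLinearMap ∘ₗ b i, fun x => ?_⟩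
  simp only [LinearMap.comp_apply, ← map_sum, ← hθ]
  exact e.symm_apply_apply x

theorem InAdd.finite (h : InAdd R X Y) [Module.Finite R Y] : Module.Finite R X := by
  obtain ⟨n, a, b, h⟩ := h
  refine Module.Finite.of_surjective (∑ i, (b i) ∘ₗ LinearMap.proj i : (Fin n → Y) →ₗ[R] X)
    fun x => ⟨fun i => a i x, ?_⟩
  simpa using h x

end InAdd

theorem addClosure_iff_inAdd {R : Type u} [Ring R] {M X : ModuleCat.{u} R} :
    addClosure M X ↔ InAdd R X M := by
  constructor
  · rintro ⟨n, Y, ⟨e⟩⟩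
    refine ⟨n, fun i => LinearMap.proj i ∘ₗ e.toLinearMap ∘ₗ LinearMap.inl R X Y,
      fun i => LinearMap.fst R X Y ∘ₗ e.symm.toLinearMap ∘ₗ LinearMap.single R (fun _ => M) i,
      fun x => ?_⟩
    simp only [LinearMap.comp_apply, ← map_sum]
    have : ∑ i, LinearMap.single R (fun _ => M) i
        ((LinearMap.proj i : (Fin n → M) →ₗ[R] M)
          (e.toLinearMap (LinearMap.inl R X Y x))) = e (x, 0) := by
      exact Finset.univ_sum_single (e (x, 0))
    rw [this]
    simp
  · rintro ⟨n, a, b, h⟩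
    let i : X →ₗ[R] (Fin n → M) := LinearMap.pi a
    let r : (Fin n → M) →ₗ[R] X := ∑ j, b j ∘ₗ LinearMap.proj j
    have hri : ∀ x, r (i x) = x := fun x => by simpa [r, i] using h x
    refine ⟨n, ModuleCat.of R (LinearMap.ker r), ⟨LinearEquiv.ofBijective
      (LinearMap.coprod i (LinearMap.ker r).subtype) ⟨?_, ?_⟩⟩⟩
    · rw [← LinearMap.ker_eq_bot, LinearMap.ker_eq_bot']
      rintro ⟨x, k, hk⟩ hx
      have hx' : i x + k = 0 := hx
      have h0 : x = 0 := by
        have := congrArg r hx'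
        rw [map_add, hri, LinearMap.mem_ker.1 hk, add_zero, map_zero] at this
        exact this
      subst h0
      rw [map_zero, zero_add] at hx'
      subst hx'
      rfl
    · intro m
      refine ⟨(r m, ⟨m - i (r m), ?_⟩), ?_⟩
      · simp [hri]
      · simp

/-! ### Presentations by projectives and the transpose of a syzygy -/

/-- The cokernel of `Hom_R(Q₁, R) → Hom_R(Q₂, R)`, a right `R`-module. -/
abbrev TrCoker {R Q₂ Q₁ : Type*} [Ring R] [AddCommGroup Q₂] [Module R Q₂] [AddCommGroup Q₁]
    [Module R Q₁] (d : Q₂ →ₗ[R] Q₁) : Type _ :=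
  (Q₂ →ₗ[R] R) ⧸ LinearMap.range (LinearMap.lcomp Rᵐᵒᵖ R d)

section Pres

variable {R : Type*} [Ring R]

/-- The beginning `Q₂ → Q₁ → Q₀ → M → 0` of a projective resolution, with finitely generated
terms. -/
structure IsPres {Q₂ Q₁ Q₀ M : Type*} [AddCommGroup Q₂] [Module R Q₂] [AddCommGroup Q₁]
    [Module R Q₁] [AddCommGroup Q₀] [Module R Q₀] [AddCommGroup M] [Module R M]
    (d₂ : Q₂ →ₗ[R] Q₁) (d₁ : Q₁ →ₗ[R] Q₀) (p : Q₀ →ₗ[R] M) : Prop where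
  finite₂ : Module.Finite R Q₂
  finite₁ : Module.Finite R Q₁
  finite₀ : Module.Finite R Q₀
  projective₂ : Module.Projective R Q₂
  projective₁ : Module.Projective R Q₁
  projective₀ : Module.Projective R Q₀
  exact₁ : Function.Exact d₂ d₁
  exact₀ : Function.Exact d₁ p
  surjective : Function.Surjective p

/-- The beginning of a minimal projective resolution: all kernels are superfluous. -/
structure IsMinPres {Q₂ Q₁ Q₀ M : Type*} [AddCommGroup Q₂] [Module R Q₂] [AddCommGroup Q₁]
    [Module R Q₁] [AddCommGroup Q₀] [Module R Q₀] [AddCommGroup M] [Module R M]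
    (d₂ : Q₂ →ₗ[R] Q₁) (d₁ : Q₁ →ₗ[R] Q₀) (p : Q₀ →ₗ[R] M) : Prop extends IsPres d₂ d₁ p where
  superfluous₂ : ∀ L : Submodule R Q₂, L ⊔ LinearMap.ker d₂ = ⊤ → L = ⊤
  superfluous₁ : ∀ L : Submodule R Q₁, L ⊔ LinearMap.ker d₁ = ⊤ → L = ⊤
  superfluous₀ : ∀ L : Submodule R Q₀, L ⊔ LinearMap.ker p = ⊤ → L = ⊤

variable {Q₂ Q₁ Q₀ M P₂ P₁ P₀ X : Type*} [AddCommGroup Q₂] [Module R Q₂] [AddCommGroup Q₁]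
    [Module R Q₁] [AddCommGroup Q₀] [Module R Q₀] [AddCommGroup M] [Module R M]
    [AddCommGroup P₂] [Module R P₂] [AddCommGroup P₁]
    [Module R P₁] [AddCommGroup P₀] [Module R P₀] [AddCommGroup X] [Module R X]
    {d₂ : Q₂ →ₗ[R] Q₁} {d₁ : Q₁ →ₗ[R] Q₀} {p : Q₀ →ₗ[R] M}
    {c₂ : P₂ →ₗ[R] P₁} {c₁ : P₁ →ₗ[R] P₀} {q : P₀ →ₗ[R] X}

/-- Lifting a map out of a projective module through one half of an exact sequence. -/
theorem exists_lift_of_exact [Module.Projective R P₂] (h : Function.Exact d₂ d₁)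
    (g : P₂ →ₗ[R] Q₁) (hg : ∀ x, d₁ (g x) = 0) :
    ∃ g' : P₂ →ₗ[R] Q₂, ∀ x, d₂ (g' x) = g x := by
  obtain ⟨g', hg'⟩ := Module.projective_lifting_property d₂.rangeRestrict
    (g.codRestrict (LinearMap.range d₂) fun x => (h (g x)).1 (hg x))
    d₂.surjective_rangeRestrict
  exact ⟨g', fun x => congrArg Subtype.val (LinearMap.congr_fun hg' x)⟩

/-- The comparison theorem for projective resolutions, in the first three degrees. -/
theorem IsPres.exists_lift (hQ : IsPres d₂ d₁ p) (hP : IsPres c₂ c₁ q) (g : M →ₗ[R] X) :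
    ∃ (g₀ : Q₀ →ₗ[R] P₀) (g₁ : Q₁ →ₗ[R] P₁) (g₂ : Q₂ →ₗ[R] P₂),
      (∀ x, q (g₀ x) = g (p x)) ∧ (∀ x, c₁ (g₁ x) = g₀ (d₁ x)) ∧
        (∀ x, c₂ (g₂ x) = g₁ (d₂ x)) := by
  have := hQ.projective₀
  have := hQ.projective₁
  have := hQ.projective₂
  obtain ⟨g₀, h₀⟩ := Module.projective_lifting_property q (g ∘ₗ p) hP.surjective
  replace h₀ : ∀ x, q (g₀ x) = g (p x) := LinearMap.congr_fun h₀
  obtain ⟨g₁, h₁⟩ := exists_lift_of_exact hP.exact₀ (g₀ ∘ₗ d₁) fun x => by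
    rw [LinearMap.comp_apply, h₀, hQ.exact₀.apply_apply_eq_zero, map_zero]
  obtain ⟨g₂, h₂⟩ := exists_lift_of_exact hP.exact₁ (g₁ ∘ₗ d₂) fun x => by
    rw [LinearMap.comp_apply, h₁, LinearMap.comp_apply, hQ.exact₁.apply_apply_eq_zero, map_zero]
  exact ⟨g₀, g₁, g₂, h₀, h₁, h₂⟩

theorem surjective_of_superfluous {θ : P₂ →ₗ[R] P₂}
    (hs : ∀ L : Submodule R P₂, L ⊔ LinearMap.ker c₂ = ⊤ → L = ⊤)
    (h : ∀ x, ∃ y, c₂ (θ y) = c₂ x) : Function.Surjective θ := by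
  rw [← LinearMap.range_eq_top]
  refine hs _ (eq_top_iff.2 fun x _ => ?_)
  obtain ⟨y, hy⟩ := h x
  exact Submodule.mem_sup.2 ⟨θ y, ⟨y, rfl⟩, x - θ y, by simp [hy], by abel⟩

/-- A chain endomorphism of a minimal resolution that lifts the identity is an isomorphism. -/
theorem IsMinPres.bijective [IsNoetherianRing R] (hP : IsMinPres c₂ c₁ q)
    (θ₀ : P₀ →ₗ[R] P₀) (θ₁ : P₁ →ₗ[R] P₁) (θ₂ : P₂ →ₗ[R] P₂)
    (h₀ : ∀ x, q (θ₀ x) = q x) (h₁ : ∀ x, c₁ (θ₁ x) = θ₀ (c₁ x))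
    (h₂ : ∀ x, c₂ (θ₂ x) = θ₁ (c₂ x)) :
    Function.Bijective θ₁ ∧ Function.Bijective θ₂ := by
  have := hP.finite₀
  have := hP.finite₁
  have := hP.finite₂
  have s₀ : Function.Surjective θ₀ :=
    surjective_of_superfluous hP.superfluous₀ fun x => ⟨x, h₀ x⟩
  have i₀ := IsNoetherian.injective_of_surjective_endomorphism θ₀ s₀
  have s₁ : Function.Surjective θ₁ := by
    refine surjective_of_superfluous hP.superfluous₁ fun x => ?_
    obtain ⟨y, hy⟩ := s₀ (c₁ x)
    obtain ⟨z, rfl⟩ := (hP.exact₀ y).1 (by rw [← h₀, hy, hP.exact₀.apply_apply_eq_zero])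
    exact ⟨z, by rw [h₁, hy]⟩
  have i₁ := IsNoetherian.injective_of_surjective_endomorphism θ₁ s₁
  have s₂ : Function.Surjective θ₂ := by
    refine surjective_of_superfluous hP.superfluous₂ fun x => ?_
    obtain ⟨y, hy⟩ := s₁ (c₂ x)
    obtain ⟨z, rfl⟩ := (hP.exact₁ y).1 (i₀ (by
      rw [← h₁, hy, hP.exact₁.apply_apply_eq_zero, map_zero]))
    exact ⟨z, by rw [h₂, hy]⟩
  exact ⟨⟨i₁, s₁⟩, ⟨IsNoetherian.injective_of_surjective_endomorphism θ₂ s₂, s₂⟩⟩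

/-- The map of cokernels `TrCoker d₂ → TrCoker c₂` induced by a commutative square from `c₂` to
`d₂`. -/
def TrCoker.map (g₂ : P₂ →ₗ[R] Q₂) (g₁ : P₁ →ₗ[R] Q₁) (h : ∀ x, d₂ (g₂ x) = g₁ (c₂ x)) :
    TrCoker d₂ →ₗ[Rᵐᵒᵖ] TrCoker c₂ :=
  Submodule.mapQ _ _ (LinearMap.lcomp Rᵐᵒᵖ R g₂) (by
    rintro _ ⟨φ, rfl⟩
    refine ⟨φ ∘ₗ g₁, ?_⟩
    ext x
    simp [h])

/-- Let `P` be the beginning of a minimal projective resolution of `X` and `Q` that of any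
projective resolution of `M`.  If `X ∈ add M`, then `Tr Ω X ∈ add (Coker (Hom(Q₁,R) → Hom(Q₂,R)))`:
the maps exhibiting `X ∈ add M` lift to the resolutions, and the resulting endomorphism of `P` is an
isomorphism by minimality. -/
theorem IsMinPres.inAdd_trCoker [IsNoetherianRing R] (hP : IsMinPres c₂ c₁ q)
    (hQ : IsPres d₂ d₁ p) (hX : InAdd R X M) : InAdd Rᵐᵒᵖ (TrCoker c₂) (TrCoker d₂) := by
  obtain ⟨n, a, b, hab⟩ := hX
  choose α₀ α₁ α₂ hα₀ hα₁ hα₂ using fun i => hP.toIsPres.exists_lift hQ (a i)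
  choose β₀ β₁ β₂ hβ₀ hβ₁ hβ₂ using fun i => hQ.exists_lift hP.toIsPres (b i)
  let θ₀ : P₀ →ₗ[R] P₀ := ∑ i, β₀ i ∘ₗ α₀ i
  let θ₁ : P₁ →ₗ[R] P₁ := ∑ i, β₁ i ∘ₗ α₁ i
  let θ₂ : P₂ →ₗ[R] P₂ := ∑ i, β₂ i ∘ₗ α₂ i
  have h₂ : ∀ x, c₂ (θ₂ x) = θ₁ (c₂ x) := fun x => by simp [θ₁, θ₂, hβ₂, hα₂]
  obtain ⟨b₁, b₂⟩ := hP.bijective θ₀ θ₁ θ₂ (fun x => by simp [θ₀, hβ₀, hα₀, hab])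
    (fun x => by simp [θ₁, θ₀, hβ₁, hα₁]) h₂
  let e₁ := LinearEquiv.ofBijective θ₁ b₁
  let e₂ := LinearEquiv.ofBijective θ₂ b₂
  have key : (fun t : TrCoker c₂ => ∑ i, TrCoker.map (α₂ i) (α₁ i) (hα₂ i)
      (TrCoker.map (β₂ i) (β₁ i) (hβ₂ i) t)) = TrCoker.map θ₂ θ₁ h₂ := by
    funext t
    obtain ⟨φ, rfl⟩ := Submodule.Quotient.mk_surjective _ t
    refine Eq.trans (b := Submodule.mkQ _ (∑ i, (φ ∘ₗ β₂ i) ∘ₗ α₂ i)) ?_ ?_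
    · rw [map_sum]
      rfl
    · refine congrArg (Submodule.mkQ _) (LinearMap.ext fun x => ?_)
      simp [θ₂, LinearMap.sum_apply]
  refine InAdd.of_bijective (fun i => TrCoker.map (β₂ i) (β₁ i) (hβ₂ i))
    (fun i => TrCoker.map (α₂ i) (α₁ i) (hα₂ i)) ?_
  rw [key]
  have h₂' : ∀ x, c₂ (e₂.symm x) = e₁.symm (c₂ x) := fun x => by
    rw [LinearEquiv.eq_symm_apply]
    exact (h₂ _).symm.trans (congrArg c₂ (e₂.apply_symm_apply x))
  refine Function.bijective_iff_has_inverse.2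
    ⟨TrCoker.map e₂.symm.toLinearMap e₁.symm.toLinearMap h₂', fun t => ?_, fun t => ?_⟩
  · obtain ⟨φ, rfl⟩ := Submodule.Quotient.mk_surjective _ t
    refine congrArg (Submodule.Quotient.mk) (LinearMap.ext fun x => ?_)
    exact congrArg φ (e₂.apply_symm_apply x)
  · obtain ⟨φ, rfl⟩ := Submodule.Quotient.mk_surjective _ t
    refine congrArg (Submodule.Quotient.mk) (LinearMap.ext fun x => ?_)
    exact congrArg φ (e₂.symm_apply_apply x)

end Pres

/-! ### Reduction along a surjective ring homomorphism -/

section Reduction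

variable {R S : Type*} [Ring R] [Ring S] {f : R →+* S}

/-- For a surjective `f : R → S` with kernel `I`, the `f`-semilinear map `π : Q → Q'` exhibits the
`S`-module `Q'` as `Q / I Q`, that is, as `S ⊗_R Q`.  Stating this as a predicate on `π` avoids
carrying two module structures on `Q'`, and applies verbatim to right modules, with `f.op`. -/
structure IsReduction {Q Q' : Type*} [AddCommGroup Q] [Module R Q] [AddCommGroup Q']
    [Module S Q'] (π : Q →ₛₗ[f] Q') : Prop where
  surjective : Function.Surjective π
  mem_of_map_eq_zero : ∀ x, π x = 0 → x ∈ (RingHom.ker f • ⊤ : Submodule R Q)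

variable {Q Q' Y Z : Type*} [AddCommGroup Q] [Module R Q] [AddCommGroup Q'] [Module S Q']
  [AddCommGroup Y] [AddCommGroup Z]

theorem map_eq_zero_of_mem_smul [Module S Y] (g : Q →ₛₗ[f] Y) {L : Submodule R Q} {x : Q}
    (hx : x ∈ RingHom.ker f • L) : g x = 0 := by
  induction hx using Submodule.smul_induction_on' with
  | smul r hr y _ => rw [map_smulₛₗ, (RingHom.mem_ker).1 hr, zero_smul]
  | add x _ y _ hx hy => rw [map_add, hx, hy, add_zero]

theorem IsReduction.map_eq_zero_iff {π : Q →ₛₗ[f] Q'} (hπ : IsReduction π) {x : Q} :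
    π x = 0 ↔ x ∈ (RingHom.ker f • ⊤ : Submodule R Q) :=
  ⟨hπ.mem_of_map_eq_zero x, map_eq_zero_of_mem_smul π⟩

/-- A reduction of `Q` is universal among semilinear maps from `Q` to `S`-modules. -/
theorem IsReduction.exists_lift {π : Q →ₛₗ[f] Q'} (hf : Function.Surjective f)
    (hπ : IsReduction π) [Module S Y] (g : Q →ₛₗ[f] Y) :
    ∃ g' : Q' →ₗ[S] Y, ∀ x, g' (π x) = g x := by
  have hg : ∀ x y, π x = π y → g x = g y := fun x y h => by
    rw [← sub_eq_zero, ← map_sub] at h ⊢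
    exact map_eq_zero_of_mem_smul g (hπ.mem_of_map_eq_zero _ h)
  let F : Q' → Y := fun y => g (Function.surjInv hπ.surjective y)
  have hF : ∀ x, F (π x) = g x := fun x => hg _ _ (Function.surjInv_eq hπ.surjective _)
  refine ⟨{ toFun := F, map_add' := fun y z => ?_, map_smul' := fun s y => ?_ }, hF⟩
  · obtain ⟨y, rfl⟩ := hπ.surjective y
    obtain ⟨z, rfl⟩ := hπ.surjective z
    rw [← map_add, hF, hF, hF, map_add]
  · obtain ⟨y, rfl⟩ := hπ.surjective y
    obtain ⟨r, rfl⟩ := hf s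
    rw [← map_smulₛₗ, hF, hF, map_smulₛₗ, RingHom.id_apply]

theorem IsReduction.exists_equiv {π : Q →ₛₗ[f] Q'} (hf : Function.Surjective f)
    (hπ : IsReduction π) [Module S Y] {g : Q →ₛₗ[f] Y} (hg : IsReduction g) :
    Nonempty (Q' ≃ₗ[S] Y) := by
  obtain ⟨a, ha⟩ := hπ.exists_lift hf g
  obtain ⟨b, hb⟩ := hg.exists_lift hf π
  refine ⟨LinearEquiv.ofLinearMap a b (LinearMap.ext fun y => ?_) (LinearMap.ext fun y => ?_)⟩
  · obtain ⟨x, rfl⟩ := hg.surjective y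
    simp [ha, hb]
  · obtain ⟨x, rfl⟩ := hπ.surjective y
    simp [ha, hb]

/-- `Q / I Q` is an `S`-module. -/
theorem exists_isReduction (hf : Function.Surjective f) (Q : Type u) [AddCommGroup Q]
    [Module R Q] : ∃ (Q' : ModuleCat.{u} S) (π : Q →ₛₗ[f] Q'), IsReduction π := by
  let N : Submodule R Q := RingHom.ker f • ⊤
  have hker : ∀ r ∈ RingHom.ker f, ∀ y : Q ⧸ N, r • y = 0 := fun r hr y => by
    obtain ⟨x, rfl⟩ := Submodule.Quotient.mk_surjective _ y
    rw [← Submodule.Quotient.mk_smul, Submodule.Quotient.mk_eq_zero]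
    exact Submodule.smul_mem_smul hr trivial
  let act : S →+* AddMonoid.End (Q ⧸ N) := f.liftOfSurjective hf
    ⟨Module.toAddMonoidEnd R (Q ⧸ N), fun r hr => AddMonoidHom.ext fun y => hker r hr y⟩
  have hact : ∀ r, act (f r) = Module.toAddMonoidEnd R (Q ⧸ N) r :=
    RingHom.liftOfRightInverse_comp_apply _ _ _ _
  let _ : Module S (Q ⧸ N) := Module.compHom (Q ⧸ N) act
  have hsmul : ∀ (r : R) (y : Q ⧸ N), f r • y = r • y := fun r y =>
    DFunLike.congr_fun (hact r) y
  let π : Q →ₛₗ[f] Q ⧸ N :=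
    { toFun := N.mkQ
      map_add' := map_add N.mkQ
      map_smul' := fun r x => (map_smul N.mkQ r x).trans (hsmul r _).symm }
  exact ⟨ModuleCat.of S (Q ⧸ N), π,
    ⟨N.mkQ_surjective, fun x hx => (Submodule.Quotient.mk_eq_zero _).1 hx⟩⟩

/-- A projective `R`-module has the lifting property against surjections of `S`-modules. -/
theorem exists_semilinear_lift [Module.Projective R Q] [Module S Y] [Module S Z]
    (h : Y →ₗ[S] Z) (hh : Function.Surjective h) (g : Q →ₛₗ[f] Z) :
    ∃ g' : Q →ₛₗ[f] Y, ∀ x, h (g' x) = g x := by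
  let _ := Module.compHom Y f
  let _ := Module.compHom Z f
  let h' : Y →ₗ[R] Z :=
    { toFun := h, map_add' := map_add h, map_smul' := fun r y => map_smul h (f r) y }
  let g₀ : Q →ₗ[R] Z :=
    { toFun := g, map_add' := map_add g, map_smul' := fun r x => map_smulₛₗ g r x }
  obtain ⟨k, hk⟩ := Module.projective_lifting_property h' g₀ hh
  exact ⟨{ toFun := k, map_add' := map_add k, map_smul' := fun r x => map_smul k r x },
    LinearMap.congr_fun hk⟩

/-- A semilinear map from a projective `R`-module to an `S`-module lifts along a surjective
semilinear map. -/
theorem exists_linear_lift [Module.Projective R Q] [Module R Y] [Module S Z]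
    (h : Y →ₛₗ[f] Z) (hh : Function.Surjective h) (g : Q →ₛₗ[f] Z) :
    ∃ g' : Q →ₗ[R] Y, ∀ x, h (g' x) = g x := by
  let _ := Module.compHom Z f
  let h' : Y →ₗ[R] Z :=
    { toFun := h, map_add' := map_add h, map_smul' := fun r y => map_smulₛₗ h r y }
  let g₀ : Q →ₗ[R] Z :=
    { toFun := g, map_add' := map_add g, map_smul' := fun r x => map_smulₛₗ g r x }
  obtain ⟨k, hk⟩ := Module.projective_lifting_property h' g₀ hh
  exact ⟨k, LinearMap.congr_fun hk⟩

theorem IsReduction.projective {π : Q →ₛₗ[f] Q'} (hf : Function.Surjective f)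
    (hπ : IsReduction π) [Module.Projective R Q] : Module.Projective S Q' := by
  refine Module.Projective.of_lifting_property'' fun h hh => ?_
  obtain ⟨g, hg⟩ := exists_semilinear_lift h hh π
  obtain ⟨g', hg'⟩ := hπ.exists_lift hf g
  refine ⟨g', LinearMap.ext fun y => ?_⟩
  obtain ⟨x, rfl⟩ := hπ.surjective y
  simp [hg', hg]

theorem IsReduction.finite {π : Q →ₛₗ[f] Q'} (hf : Function.Surjective f)
    (hπ : IsReduction π) [Module.Finite R Q] : Module.Finite S Q' :=
  haveI : RingHomSurjective f := ⟨hf⟩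
  Module.Finite.of_surjective π hπ.surjective

/-- The universal map `x ↦ 1 ⊗ x` exhibits `S ⊗_R X` as the reduction of `X`. -/
theorem exists_isReduction_tensorObj {R S : Type u} [Ring R] [Ring S] {f : R →+* S}
    (hf : Function.Surjective f) (X : ModuleCat.{u} R) :
    ∃ π : X →ₛₗ[f] tensorObj f X, IsReduction π := by
  let N : Submodule S (S ⊗[ℤ] X) := Submodule.span S
    {t : S ⊗[ℤ] X | ∃ (s : S) (r : R) (x : X), t = (s * f r) ⊗ₜ[ℤ] x - s ⊗ₜ[ℤ] (r • x)}
  have hrel : ∀ (s : S) (r : R) (x : X),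
      N.mkQ ((s * f r) ⊗ₜ[ℤ] x) = N.mkQ (s ⊗ₜ[ℤ] (r • x)) := fun s r x => by
    rw [← sub_eq_zero, ← map_sub, Submodule.mkQ_apply, Submodule.Quotient.mk_eq_zero]
    exact Submodule.subset_span ⟨s, r, x, rfl⟩
  let π : X →ₛₗ[f] (S ⊗[ℤ] X) ⧸ N :=
    { toFun := fun x => N.mkQ (1 ⊗ₜ[ℤ] x)
      map_add' := fun x y => by rw [TensorProduct.tmul_add, map_add]
      map_smul' := fun r x => by
        rw [← hrel, ← map_smul, TensorProduct.smul_tmul', smul_eq_mul, one_mul, mul_one] }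
  refine ⟨π, (⟨fun y => ?_, fun x hx => ?_⟩ : IsReduction π)⟩
  · obtain ⟨t, rfl⟩ := N.mkQ_surjective y
    induction t with
    | zero => exact ⟨0, by rw [map_zero, map_zero]⟩
    | tmul s x =>
      obtain ⟨r, rfl⟩ := hf s
      refine ⟨r • x, ?_⟩
      change N.mkQ (1 ⊗ₜ[ℤ] (r • x)) = _
      rw [← hrel, one_mul]
    | add a b ha hb =>
      obtain ⟨x, hx⟩ := ha
      obtain ⟨y, hy⟩ := hb
      exact ⟨x + y, by rw [map_add, hx, hy, map_add]⟩
  · obtain ⟨Q', ρ, hρ⟩ := exists_isReduction hf X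
    let F₀ : S ⊗[ℤ] X →+ Q' := TensorProduct.liftAddHom
      { toFun := fun s => (DistribSMul.toAddMonoidHom Q' s).comp ρ.toAddMonoidHom
        map_zero' := AddMonoidHom.ext fun x => zero_smul S _
        map_add' := fun s t => AddMonoidHom.ext fun x => add_smul s t _ }
      fun n s x => by
        change (n • s) • ρ x = s • ρ (n • x)
        rw [map_zsmul, smul_assoc, smul_comm]
    have hF₀ : ∀ s x, F₀ (s ⊗ₜ x) = s • ρ x := fun s x => rfl
    let F : S ⊗[ℤ] X →ₗ[S] Q' :=
      { toFun := F₀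
        map_add' := map_add F₀
        map_smul' := fun s t => by
          induction t with
          | zero => simp
          | tmul a x =>
            rw [TensorProduct.smul_tmul', hF₀, hF₀, smul_eq_mul, mul_smul, RingHom.id_apply]
          | add a b ha hb => rw [smul_add, map_add, ha, hb, map_add, smul_add] }
    have hN : N ≤ LinearMap.ker F := Submodule.span_le.2 <| by
      rintro _ ⟨s, r, x, rfl⟩
      refine (LinearMap.mem_ker (f := F)).2 ?_
      rw [show F _ = F₀ _ from rfl, map_sub, hF₀, hF₀, map_smulₛₗ, mul_smul, sub_self]
    have h1 : F (1 ⊗ₜ x) = 0 := hN ((Submodule.Quotient.mk_eq_zero _).1 hx)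
    refine hρ.mem_of_map_eq_zero x ?_
    rw [← one_smul S (ρ x)]
    exact h1

end Reduction

/-! ### Reducing presentations and transposes -/

section Transpose

variable {R S : Type*} [Ring R] [Ring S] {f : R →+* S}

/-- Composition with `f` turns functionals on `Q` into functionals on a reduction of `Q`. -/
theorem IsReduction.exists_dual {Q Q' : Type*} [AddCommGroup Q] [Module R Q] [AddCommGroup Q']
    [Module S Q'] {π : Q →ₛₗ[f] Q'} (hf : Function.Surjective f) (hπ : IsReduction π) :
    ∃ H : (Q →ₗ[R] R) →ₛₗ[f.op] (Q' →ₗ[S] S), ∀ h x, H h (π x) = f (h x) := by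
  have key : ∀ h : Q →ₗ[R] R, ∃ h' : Q' →ₗ[S] S, ∀ x, h' (π x) = f (h x) := fun h =>
    hπ.exists_lift hf
      ({ toFun := fun x => f (h x), map_add' := by simp, map_smul' := by simp } : Q →ₛₗ[f] S)
  choose H hH using key
  refine ⟨{ toFun := H, map_add' := fun a b => ?_, map_smul' := fun r a => ?_ }, hH⟩
  · ext y
    obtain ⟨x, rfl⟩ := hπ.surjective y
    simp [hH]
  · ext y
    obtain ⟨x, rfl⟩ := hπ.surjective y
    simp [hH]

theorem surjective_of_dual {Q Q' : Type*} [AddCommGroup Q] [Module R Q] [AddCommGroup Q']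
    [Module S Q'] [Module.Projective R Q] {π : Q →ₛₗ[f] Q'} (hf : Function.Surjective f)
    (hπ : IsReduction π) {H : (Q →ₗ[R] R) →ₛₗ[f.op] (Q' →ₗ[S] S)}
    (hH : ∀ h x, H h (π x) = f (h x)) : Function.Surjective H := by
  intro h'
  obtain ⟨h, hh⟩ := exists_linear_lift (f := f)
    ({ toFun := f, map_add' := map_add f, map_smul' := by simp } : R →ₛₗ[f] S) hf
    (h'.comp π : Q →ₛₗ[f] S)
  refine ⟨h, LinearMap.ext fun y => ?_⟩
  obtain ⟨x, rfl⟩ := hπ.surjective y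
  rw [hH]
  exact hh x

/-- For `Q` finitely generated projective, `Hom_R(Q, I) = Hom_R(Q, R) I`. -/
theorem mem_smul_top_of_forall_map_eq_zero {Q : Type*} [AddCommGroup Q] [Module R Q]
    [Module.Projective R Q] [Module.Finite R Q] (k : Q →ₗ[R] R) (hk : ∀ x, f (k x) = 0) :
    k ∈ (RingHom.ker f.op • ⊤ : Submodule Rᵐᵒᵖ (Q →ₗ[R] R)) := by
  obtain ⟨n, g, hg⟩ := Module.Finite.exists_fin' R Q
  obtain ⟨s, hs⟩ := Module.projective_lifting_property g LinearMap.id hg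
  -- The functionals `proj i ∘ s` and the elements `g (e i)` form a dual basis of `Q`.
  have : k = ∑ i, MulOpposite.op (k (g (Pi.single i 1))) • (LinearMap.proj i ∘ₗ s) := by
    ext x
    have hx : g (s x) = x := LinearMap.congr_fun hs x
    conv_lhs => rw [← hx, ← Finset.univ_sum_single (s x)]
    simp only [map_sum, LinearMap.sum_apply, LinearMap.smul_apply, LinearMap.comp_apply,
      LinearMap.proj_apply, op_smul_eq_mul]
    refine Finset.sum_congr rfl fun i _ => ?_
    rw [← smul_eq_mul, ← map_smul, ← map_smul, ← Pi.single_smul, smul_eq_mul,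
      mul_one]
  rw [this]
  refine Submodule.sum_mem _ fun i _ => Submodule.smul_mem_smul ?_ trivial
  exact (RingHom.mem_ker).2 (congrArg MulOpposite.op (hk _))

variable {Q₂ Q₁ Q₀ M N : Type u} [AddCommGroup Q₂] [Module R Q₂] [AddCommGroup Q₁]
    [Module R Q₁] [AddCommGroup Q₀] [Module R Q₀] [AddCommGroup M] [Module R M]
    [AddCommGroup N] [Module S N]
    {d₂ : Q₂ →ₗ[R] Q₁} {d₁ : Q₁ →ₗ[R] Q₀} {p : Q₀ →ₗ[R] M}

/-- Reduction of a projective presentation.  The hypothesis `hTor` says that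
`I ⊗ Ker p → I Q₀ ∩ Ker p` is onto, i.e. that `Tor₁(S, M) = 0`; it makes the reduced complex exact
in degree one. -/
theorem IsPres.exists_reduction (hf : Function.Surjective f) (hQ : IsPres d₂ d₁ p)
    {πM : M →ₛₗ[f] N} (hπM : IsReduction πM)
    (hTor : ∀ x, p x = 0 → x ∈ (RingHom.ker f • ⊤ : Submodule R Q₀) →
      x ∈ RingHom.ker f • LinearMap.ker p) :
    ∃ (Q₂' Q₁' Q₀' : ModuleCat.{u} S) (d₂' : Q₂' →ₗ[S] Q₁') (d₁' : Q₁' →ₗ[S] Q₀')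
      (p' : Q₀' →ₗ[S] N), IsPres d₂' d₁' p' ∧
        ∃ ρ : TrCoker d₂ →ₛₗ[f.op] TrCoker d₂', IsReduction ρ := by
  obtain ⟨Q₂', π₂, h₂⟩ := exists_isReduction hf Q₂
  obtain ⟨Q₁', π₁, h₁⟩ := exists_isReduction hf Q₁
  obtain ⟨Q₀', π₀, h₀⟩ := exists_isReduction hf Q₀
  obtain ⟨d₂', hd₂⟩ := h₂.exists_lift hf (π₁.comp d₂ : Q₂ →ₛₗ[f] Q₁')
  obtain ⟨d₁', hd₁⟩ := h₁.exists_lift hf (π₀.comp d₁ : Q₁ →ₛₗ[f] Q₀')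
  obtain ⟨p', hp⟩ := h₀.exists_lift hf (πM.comp p : Q₀ →ₛₗ[f] N)
  simp only [LinearMap.comp_apply] at hd₂ hd₁ hp
  have := hQ.finite₂
  have := hQ.finite₁
  have := hQ.finite₀
  have := hQ.projective₂
  have := hQ.projective₁
  have := hQ.projective₀
  refine ⟨Q₂', Q₁', Q₀', d₂', d₁', p', ⟨h₂.finite hf, h₁.finite hf, h₀.finite hf,
    h₂.projective hf, h₁.projective hf, h₀.projective hf, ?_, ?_, ?_⟩, ?_⟩
  · intro y
    constructor
    · intro hy
      obtain ⟨x, rfl⟩ := h₁.surjective y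
      have hx := hTor (d₁ x) (hQ.exact₀.apply_apply_eq_zero x)
        (h₀.mem_of_map_eq_zero _ (by rw [← hd₁, hy]))
      rw [hQ.exact₀.linearMap_ker_eq, ← Submodule.map_top, ← Submodule.map_smul''] at hx
      obtain ⟨z, hz, hzx⟩ := hx
      obtain ⟨w, hw⟩ := (hQ.exact₁ (x - z)).1 (by rw [map_sub, hzx, sub_self])
      exact ⟨π₂ w, by rw [hd₂, hw, map_sub, h₁.map_eq_zero_iff.2 hz, sub_zero]⟩
    · rintro ⟨x, rfl⟩
      obtain ⟨x, rfl⟩ := h₂.surjective x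
      rw [hd₂, hd₁, hQ.exact₁.apply_apply_eq_zero, map_zero]
  · intro y
    constructor
    · intro hy
      obtain ⟨x, rfl⟩ := h₀.surjective y
      have hx := hπM.mem_of_map_eq_zero (p x) (by rw [← hp, hy])
      rw [← LinearMap.range_eq_top.2 hQ.surjective, ← Submodule.map_top,
        ← Submodule.map_smul''] at hx
      obtain ⟨z, hz, hzx⟩ := hx
      obtain ⟨w, hw⟩ := (hQ.exact₀ (x - z)).1 (by rw [map_sub, hzx, sub_self])
      exact ⟨π₁ w, by rw [hd₁, hw, map_sub, h₀.map_eq_zero_iff.2 hz, sub_zero]⟩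
    · rintro ⟨x, rfl⟩
      obtain ⟨x, rfl⟩ := h₁.surjective x
      rw [hd₁, hp, hQ.exact₀.apply_apply_eq_zero, map_zero]
  · intro y
    obtain ⟨y, rfl⟩ := hπM.surjective y
    obtain ⟨x, rfl⟩ := hQ.surjective y
    exact ⟨π₀ x, hp x⟩
  · obtain ⟨H₂, hH₂⟩ := h₂.exists_dual hf
    obtain ⟨H₁, hH₁⟩ := h₁.exists_dual hf
    have hcomm : ∀ g, H₂ (g ∘ₗ d₂) = H₁ g ∘ₗ d₂' := fun g => LinearMap.ext fun y => by
      obtain ⟨x, rfl⟩ := h₂.surjective y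
      rw [hH₂, LinearMap.comp_apply, LinearMap.comp_apply, hd₂, hH₁]
    refine ⟨Submodule.mapQ _ _ H₂ ?_, ⟨fun t => ?_, fun t ht => ?_⟩⟩
    · rintro _ ⟨g, rfl⟩
      exact ⟨H₁ g, (hcomm g).symm⟩
    · obtain ⟨h', rfl⟩ := Submodule.Quotient.mk_surjective _ t
      obtain ⟨h, rfl⟩ := surjective_of_dual hf h₂ hH₂ h'
      exact ⟨Submodule.Quotient.mk h, rfl⟩
    · obtain ⟨h, rfl⟩ := Submodule.Quotient.mk_surjective _ t
      rw [Submodule.mapQ_apply, Submodule.Quotient.mk_eq_zero] at ht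
      obtain ⟨g', hg'⟩ := ht
      obtain ⟨g, rfl⟩ := surjective_of_dual hf h₁ hH₁ g'
      replace hg' : H₂ (g ∘ₗ d₂) = H₂ h := (hcomm g).trans hg'
      have hk := mem_smul_top_of_forall_map_eq_zero (f := f) (h - g ∘ₗ d₂) fun x => by
        rw [LinearMap.sub_apply, map_sub, ← hH₂, ← hH₂, hg', sub_self]
      have hmk : (Submodule.Quotient.mk h : TrCoker d₂) = Submodule.mkQ _ (h - g ∘ₗ d₂) := by
        rw [map_sub, Submodule.mkQ_apply, Submodule.mkQ_apply,
          (Submodule.Quotient.mk_eq_zero (LinearMap.range (LinearMap.lcomp Rᵐᵒᵖ R d₂))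
            (x := g ∘ₗ d₂)).2 ⟨g, rfl⟩, sub_zero]
      rw [hmk]
      have := Submodule.mem_map_of_mem (f := Submodule.mkQ
        (LinearMap.range (LinearMap.lcomp Rᵐᵒᵖ R d₂))) hk
      rw [Submodule.map_smul''] at this
      exact Submodule.smul_mono le_rfl le_top this

end Transpose

/-! ### Existence of projective covers and injective envelopes -/

section Covers

variable {R : Type u} [Ring R]

theorem injective_of_retract {I J : Type u} [AddCommGroup I] [Module R I] [AddCommGroup J]
    [Module R J] [Module.Injective.{u, u} R I] (i : J →ₗ[R] I) (r : I →ₗ[R] J)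
    (h : ∀ x, r (i x) = x) : Module.Injective.{u, u} R J where
  out X Y _ _ _ _ f hf g := by
    obtain ⟨k, hk⟩ := Module.Injective.out f hf (i ∘ₗ g)
    exact ⟨r ∘ₗ k, fun x => by simp [hk, h]⟩

variable [IsArtinianRing R] [IsNoetherianRing R]

/-- Among the projective submodules of a free module that still map onto `X`, a minimal one is a
projective cover: if `L' + Ker = L`, lift `L → X` through `L' → X` to an endomorphism `φ` of `L`;
by Fitting's lemma the image of a power of `φ` is a direct summand, so it is all of `L`. -/
theorem exists_isProjectiveCover (X : Type u) [AddCommGroup X] [Module R X] [Module.Finite R X] :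
    ∃ (P : ModuleCat.{u} R) (p : P →ₗ[R] X), IsProjectiveCover p := by
  obtain ⟨n, g, hg⟩ := Module.Finite.exists_fin' R X
  obtain ⟨L, ⟨hLproj, hLg⟩, hmin⟩ := IsArtinian.set_has_minimal
    {L : Submodule R (Fin n → R) | Module.Projective R L ∧ L.map g = ⊤}
    ⟨⊤, Module.Projective.of_equiv Submodule.topEquiv.symm, by
      rw [Submodule.map_top, LinearMap.range_eq_top.2 hg]⟩
  let p : L →ₗ[R] X := g ∘ₗ L.subtype
  have hp : Function.Surjective p := by
    rw [← LinearMap.range_eq_top, LinearMap.range_comp, Submodule.range_subtype, hLg]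
  refine ⟨ModuleCat.of R L, p, ⟨inferInstanceAs (Module.Finite R L), hLproj, hp, fun L' hL' => ?_⟩⟩
  have hpL' : Function.Surjective (p ∘ₗ L'.subtype) := by
    intro x
    obtain ⟨y, rfl⟩ := hp x
    obtain ⟨a, ha, b, hb, rfl⟩ := Submodule.mem_sup.1 (hL' ▸ Submodule.mem_top : y ∈ L' ⊔ _)
    exact ⟨⟨a, ha⟩, by simp [LinearMap.mem_ker.1 hb]⟩
  obtain ⟨h, hh⟩ := Module.projective_lifting_property (p ∘ₗ L'.subtype) p hpL'
  let φ : Module.End R L := L'.subtype ∘ₗ h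
  have hφ : ∀ (n : ℕ) x, p ((φ ^ n) x) = p x := fun n x => by
    induction n with
    | zero => simp
    | succ n ih =>
      rw [pow_succ', Module.End.mul_apply]
      exact (LinearMap.congr_fun hh _).trans ih
  obtain ⟨m, hm⟩ := Filter.eventually_atTop.1 φ.eventually_isCompl_ker_pow_range_pow
  have hc := hm (m + 1) (Nat.le_succ m)
  let W := LinearMap.range (φ ^ (m + 1))
  have hW : Module.Projective R W :=
    Module.Projective.of_split W.subtype (W.projectionOnto _ hc.symm)
      (LinearMap.ext fun x => Submodule.projectionOnto_apply_left hc.symm x)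
  have hWtop : W.map L.subtype = L := by
    refine eq_of_le_of_not_lt (Submodule.map_subtype_le _ _) (hmin _ ⟨?_, ?_⟩)
    · exact Module.Projective.of_equiv (Submodule.equivSubtypeMap L W)
    · rw [← Submodule.map_comp, eq_top_iff]
      intro x _
      obtain ⟨y, rfl⟩ := hp x
      exact ⟨_, ⟨y, rfl⟩, hφ (m + 1) y⟩
  refine eq_top_iff.2 fun x _ => ?_
  obtain ⟨y, ⟨z, rfl⟩, hy⟩ := (hWtop.symm ▸ x.2 : (x : Fin n → R) ∈ W.map L.subtype)
  rw [← Subtype.ext hy, pow_succ', Module.End.mul_apply]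
  exact (h _).2

/-- A module embedded in a finitely generated injective module has an injective envelope, by the
argument dual to `exists_isProjectiveCover`. -/
theorem exists_isInjectiveEnvelope_of_embedding {X I : Type u} [AddCommGroup X] [Module R X]
    [AddCommGroup I] [Module R I] [Module.Finite R I] [Module.Injective.{u, u} R I]
    (j : X →ₗ[R] I) (hj : Function.Injective j) :
    ∃ (E : ModuleCat.{u} R) (i : X →ₗ[R] E), IsInjectiveEnvelope i := by
  obtain ⟨L, ⟨hLinj, hLj⟩, hmin⟩ := IsArtinian.set_has_minimal
    {L : Submodule R I | Module.Injective.{u, u} R L ∧ LinearMap.range j ≤ L}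
    ⟨⊤, injective_of_retract (I := I) Submodule.topEquiv.toLinearMap
      Submodule.topEquiv.symm.toLinearMap (fun _ => rfl), le_top⟩
  let i : X →ₗ[R] L := j.codRestrict L fun x => hLj ⟨x, rfl⟩
  have hi : Function.Injective i := fun x y h => hj (congrArg Subtype.val h)
  refine ⟨ModuleCat.of R L, i, ⟨inferInstanceAs (Module.Finite R L), hLinj, hi, fun L' hL' => ?_⟩⟩
  obtain ⟨h, hh⟩ := hLinj.out (L'.mkQ ∘ₗ i) (by
    rw [← LinearMap.ker_eq_bot, LinearMap.ker_eq_bot']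
    intro x hx
    have h1 : i x ∈ L' ⊓ LinearMap.range i :=
      ⟨(Submodule.Quotient.mk_eq_zero _).1 hx, x, rfl⟩
    rw [hL', Submodule.mem_bot] at h1
    exact hi (h1.trans (map_zero i).symm)) i
  let φ : Module.End R L := h ∘ₗ L'.mkQ
  have hφ : ∀ (n : ℕ) x, (φ ^ n) (i x) = i x := fun n x => by
    induction n with
    | zero => simp
    | succ n ih =>
      rw [pow_succ', Module.End.mul_apply, ih]
      exact hh x
  obtain ⟨m, hm⟩ := Filter.eventually_atTop.1 φ.eventually_isCompl_ker_pow_range_pow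
  have hc := hm (m + 1) (Nat.le_succ m)
  let W := LinearMap.range (φ ^ (m + 1))
  have hW : Module.Injective.{u, u} R W :=
    injective_of_retract W.subtype (W.projectionOnto _ hc.symm)
      (fun x => Submodule.projectionOnto_apply_left hc.symm x)
  have hWtop : W.map L.subtype = L := by
    refine eq_of_le_of_not_lt (Submodule.map_subtype_le _ _) (hmin _ ⟨?_, ?_⟩)
    · exact injective_of_retract (Submodule.equivSubtypeMap L W).symm.toLinearMap
        (Submodule.equivSubtypeMap L W).toLinearMap (by simp)
    · rintro _ ⟨x, rfl⟩
      exact ⟨i x, ⟨i x, hφ _ x⟩, rfl⟩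
  have hW' : W = ⊤ := by
    rw [eq_top_iff]
    intro x _
    obtain ⟨y, hyW, hy⟩ := (hWtop.symm ▸ x.2 : (x : I) ∈ W.map L.subtype)
    rwa [← Subtype.ext hy]
  have hker : LinearMap.ker (φ ^ (m + 1)) = ⊥ := by
    have := hc.inf_eq_bot
    rwa [show LinearMap.range (φ ^ (m + 1)) = ⊤ from hW', inf_top_eq] at this
  rw [eq_bot_iff, ← hker]
  intro x hx
  rw [LinearMap.mem_ker, pow_succ, Module.End.mul_apply]
  have : φ x = 0 := by
    change h (L'.mkQ x) = 0
    rw [Submodule.mkQ_apply, (Submodule.Quotient.mk_eq_zero _).2 hx, map_zero]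
  rw [this, map_zero]

end Covers

/-! ### Coreduction along a surjective ring homomorphism -/

section Coreduction

variable {R S : Type*} [Ring R] [Ring S]

/-- For a surjective `f : R → S` with kernel `I`, the map `ι : N → M` exhibits the `S`-module `N`
as the largest submodule of `M` annihilated by `I`, that is, as `Hom_R(S, M)`. -/
structure IsCoreduction (f : R →+* S) {N M : Type*} [AddCommGroup N] [Module S N]
    [AddCommGroup M] [Module R M] (ι : N →+ M) : Prop where
  injective : Function.Injective ι
  map_smul : ∀ r n, ι (f r • n) = r • ι n
  mem_range : ∀ m, (∀ r, f r = 0 → r • m = 0) → ∃ n, ι n = m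

variable {f : R →+* S} {N M X : Type*} [AddCommGroup N] [Module S N]
    [AddCommGroup M] [Module R M] [AddCommGroup X]

/-- A coreduction of `M` is universal among linear maps to `M` whose image is killed by `I`. -/
theorem IsCoreduction.exists_lift {ι : N →+ M} (hι : IsCoreduction f ι) [Module R X]
    (g : X →ₗ[R] M) (hg : ∀ r, f r = 0 → ∀ x, r • g x = 0) :
    ∃ g' : X →ₛₗ[f] N, ∀ x, ι (g' x) = g x := by
  choose F hF using fun x => hι.mem_range (g x) fun r hr => hg r hr x
  refine ⟨{ toFun := F, map_add' := fun x y => ?_, map_smul' := fun r x => ?_ }, hF⟩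
  · exact hι.injective (by rw [map_add, hF, hF, hF, map_add])
  · exact hι.injective (by rw [hι.map_smul, hF, hF, LinearMap.map_smul])

/-- Additive maps out of an `S`-module that are compatible with `f` factor through coreductions. -/
theorem IsCoreduction.exists_lift_addMonoidHom {ι : N →+ M} (hf : Function.Surjective f)
    (hι : IsCoreduction f ι) [Module S X] (g : X →+ M) (hg : ∀ r x, g (f r • x) = r • g x) :
    ∃ g' : X →ₗ[S] N, ∀ x, ι (g' x) = g x := by
  choose F hF using fun x => hι.mem_range (g x) fun r hr => by
    rw [← hg, hr, zero_smul, map_zero]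
  refine ⟨{ toFun := F, map_add' := fun x y => ?_, map_smul' := fun s x => ?_ }, hF⟩
  · exact hι.injective (by rw [map_add, hF, hF, hF, map_add])
  · obtain ⟨r, rfl⟩ := hf s
    exact hι.injective (by rw [RingHom.id_apply, hι.map_smul, hF, hF, hg])

theorem IsCoreduction.exists_equiv {ι : N →+ M} (hf : Function.Surjective f)
    (hι : IsCoreduction f ι) [Module S X] {g : X →+ M} (hg : IsCoreduction f g) :
    Nonempty (X ≃ₗ[S] N) := by
  obtain ⟨a, ha⟩ := hι.exists_lift_addMonoidHom hf g hg.map_smul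
  obtain ⟨b, hb⟩ := hg.exists_lift_addMonoidHom hf ι hι.map_smul
  exact ⟨LinearEquiv.ofLinearMap a b
    (LinearMap.ext fun y => hι.injective (by simp [ha, hb]))
    (LinearMap.ext fun y => hg.injective (by simp [ha, hb]))⟩

/-- An element killed by the kernel of `f` is the image of `1` under an `R`-linear map from `S`. -/
theorem exists_linearMap_apply_one {R S : Type u} [Ring R] [Ring S] {f : R →+* S}
    (hf : Function.Surjective f) {M : ModuleCat.{u} R} (m : M) (hm : ∀ r, f r = 0 → r • m = 0) :
    ∃ g : (ModuleCat.restrictScalars f).obj (ModuleCat.of S S) →ₗ[R] M, g (1 : S) = m := by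
  have hwd : ∀ r r', f r = f r' → r • m = r' • m := fun r r' h => by
    rw [← sub_eq_zero, ← sub_smul]
    exact hm _ (by rw [map_sub, h, sub_self])
  let F : S → M := fun s => Function.surjInv hf s • m
  have hF : ∀ r, F (f r) = r • m := fun r => hwd _ _ (Function.surjInv_eq hf _)
  let g : (ModuleCat.restrictScalars f).obj (ModuleCat.of S S) →ₗ[R] M :=
    { toFun := F
      map_add' := fun s t => by
        obtain ⟨a, rfl⟩ := hf s
        obtain ⟨b, rfl⟩ := hf t
        change F (f a + f b) = F (f a) + F (f b)
        rw [← map_add, hF, hF, hF, add_smul]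
      map_smul' := fun r s => by
        obtain ⟨a, rfl⟩ := hf s
        change F (f r * f a) = r • F (f a)
        rw [← map_mul, hF, hF, mul_smul] }
  refine ⟨g, ?_⟩
  change F 1 = m
  rw [← map_one f, hF, one_smul]

/-- Evaluation at `1` exhibits `Hom_R(S, M)` as the coreduction of `M`. -/
theorem exists_isCoreduction_coextendScalars {R S : Type u} [Ring R] [Ring S] {f : R →+* S}
    (hf : Function.Surjective f) (M : ModuleCat.{u} R) :
    ∃ ι : (ModuleCat.coextendScalars f).obj M →+ M, IsCoreduction f ι := by
  let ev (s : S) (g : (ModuleCat.coextendScalars f).obj M) : M :=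
    ModuleCat.CoextendScalars.equiv f M g s
  have hev : ∀ r g, ev (f r) g = r • ev 1 g := fun r g => by
    have := (ModuleCat.CoextendScalars.equiv f M g).map_smul r (1 : S)
    refine Eq.trans (congrArg (ModuleCat.CoextendScalars.equiv f M g) ?_) this
    exact (mul_one (f r)).symm
  refine ⟨{ toFun := ev 1, map_zero' := rfl, map_add' := fun g h => rfl }, ⟨?_, ?_, ?_⟩⟩
  · intro g h hgh
    refine ModuleCat.CoextendScalars.ext (LinearMap.ext fun s => ?_)
    obtain ⟨r, rfl⟩ := hf s
    exact (hev r g).trans ((congrArg (r • ·) hgh).trans (hev r h).symm)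
  · intro r g
    refine Eq.trans ?_ (hev r g)
    exact congrArg (ModuleCat.CoextendScalars.equiv f M g) (one_mul (f r))
  · intro m hm
    obtain ⟨g, hg⟩ := exists_linearMap_apply_one hf m hm
    exact ⟨(ModuleCat.CoextendScalars.equiv f M).symm g, hg⟩

end Coreduction

/-! ### The duality `D` on linear maps -/

section Dual

variable {K : Type u} [Field K] {R S : Type u} [Ring R] [Algebra K R] [Ring S] [Algebra K S]

/-- An element of `D N` as a `K`-linear functional on `N`. -/
def dualEval {N : ModuleCat.{u} R} (φ : dual K N) : N →ₗ[K] K := φ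

/-- A `K`-linear functional on `N` as an element of `D N`. -/
def dualMk {N : ModuleCat.{u} R} (g : N →ₗ[K] K) : dual K N := g

section

variable {N : ModuleCat.{u} R}

theorem dual_ext {φ ψ : dual K N} (h : ∀ x, dualEval φ x = dualEval ψ x) : φ = ψ :=
  LinearMap.ext (f := dualEval φ) (g := dualEval ψ) h

theorem dualEval_mk (g : N →ₗ[K] K) (x : N) : dualEval (dualMk g) x = g x := rfl

theorem dualEval_add (φ ψ : dual K N) (x : N) :
    dualEval (φ + ψ) x = dualEval φ x + dualEval ψ x := rfl

theorem dualEval_smul (r : Rᵐᵒᵖ) (φ : dual K N) (x : N) :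
    dualEval (r • φ) x = dualEval φ (r.unop • x) := rfl

theorem eq_zero_of_forall_dualEval {x : N} (h : ∀ φ : dual K N, dualEval φ x = 0) : x = 0 :=
  (Module.forall_dual_apply_eq_zero_iff K x).1 fun φ => h (dualMk φ)

theorem algebraMap_smul_moduleCat (k : K) (x : N) : algebraMap K R k • x = k • x :=
  algebraMap_smul R k x

/-- `D N` as a vector space. -/
def dualEquiv (N : ModuleCat.{u} R) : Module.Dual K N ≃ₗ[K] dual K N where
  toFun g := dualMk g
  invFun φ := dualEval φ
  map_add' _ _ := rfl
  map_smul' k g := dual_ext fun x => by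
    rw [← algebraMap_smul_moduleCat, dualEval_smul, MulOpposite.algebraMap_apply,
      MulOpposite.unop_op, algebraMap_smul_moduleCat, dualEval_mk, dualEval_mk, RingHom.id_apply,
      map_smul, LinearMap.smul_apply]

theorem finite_of_finite [Module.Finite K R] (N : ModuleCat.{u} R) [Module.Finite R N] :
    Module.Finite K N :=
  Module.Finite.trans R N

theorem finite_dual (N : ModuleCat.{u} R) [Module.Finite K N] : Module.Finite Rᵐᵒᵖ (dual K N) :=
  haveI : Module.Finite K (dual K N) := Module.Finite.equiv (dualEquiv N)
  Module.Finite.of_restrictScalars_finite K Rᵐᵒᵖ (dual K N)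

/-- In finite dimension a submodule of `D N` is determined by its annihilator in `N`. -/
theorem mem_of_forall_dualEval_eq_zero [Module.Finite K N] (L : Submodule Rᵐᵒᵖ (dual K N))
    (φ : dual K N) (h : ∀ x, (∀ l ∈ L, dualEval l x = 0) → dualEval φ x = 0) : φ ∈ L := by
  by_contra hφ
  let L' : Submodule K (Module.Dual K N) :=
    (L.restrictScalars K).comap (dualEquiv N).toLinearMap
  obtain ⟨F, hF, hL⟩ := L'.exists_dual_map_eq_bot_of_notMem (x := dualEval φ) hφ inferInstance
  obtain ⟨x, rfl⟩ := (Module.evalEquiv K N).surjective F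
  refine hF (h x fun l hl => ?_)
  have : Module.evalEquiv K N x (dualEval l) ∈ L'.map (Module.evalEquiv K N x) :=
    ⟨dualEval l, hl, rfl⟩
  rw [hL] at this
  exact this

end

/-- The transpose `D Y → D X` of a linear map `X → Y`. -/
def dualMap {X Y : ModuleCat.{u} R} (g : X →ₗ[R] Y) : dual K Y →ₗ[Rᵐᵒᵖ] dual K X where
  toFun φ := dualMk (dualEval φ ∘ₗ g.restrictScalars K)
  map_add' _ _ := rfl
  map_smul' r φ := dual_ext fun x => congrArg (dualEval φ) (g.map_smul r.unop x).symm

theorem dualEval_dualMap {X Y : ModuleCat.{u} R} (g : X →ₗ[R] Y) (φ : dual K Y) (x : X) :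
    dualEval (dualMap g φ) x = dualEval φ (g x) := rfl

theorem dualMap_injective {X Y : ModuleCat.{u} R} {g : X →ₗ[R] Y} (hg : Function.Surjective g) :
    Function.Injective (dualMap (K := K) g) := fun φ ψ h => dual_ext fun y => by
  obtain ⟨x, rfl⟩ := hg y
  exact congrArg (fun χ => dualEval χ x) h

theorem dualMap_surjective {X Y : ModuleCat.{u} R} {g : X →ₗ[R] Y} (hg : Function.Injective g) :
    Function.Surjective (dualMap (K := K) g) := fun φ => by
  obtain ⟨s, hs⟩ := (g.restrictScalars K).exists_leftInverse_of_injective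
    (LinearMap.ker_eq_bot.2 hg)
  exact ⟨dualMk (dualEval φ ∘ₗ s), dual_ext fun x =>
    congrArg (dualEval φ) (LinearMap.congr_fun hs x)⟩

theorem dualMap_exact {X Y Z : ModuleCat.{u} R} {g : X →ₗ[R] Y} {h : Y →ₗ[R] Z}
    (hh : Function.Surjective h) (hgh : Function.Exact g h) :
    Function.Exact (dualMap (K := K) h) (dualMap (K := K) g) := fun φ => by
  constructor
  · intro hφ
    obtain ⟨s, hs⟩ := (h.restrictScalars K).exists_rightInverse_of_surjective
      (LinearMap.range_eq_top.2 hh)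
    refine ⟨dualMk (dualEval φ ∘ₗ s), dual_ext fun y => ?_⟩
    obtain ⟨x, hx⟩ := (hgh (s (h y) - y)).1 (by
      rw [map_sub, sub_eq_zero]; exact LinearMap.congr_fun hs (h y))
    change dualEval φ (s (h y)) = dualEval φ y
    rw [← sub_eq_zero, ← map_sub, ← hx]
    exact congrArg (fun χ => dualEval χ x) hφ
  · rintro ⟨ψ, rfl⟩
    refine dual_ext fun x => ?_
    rw [dualEval_dualMap, dualEval_dualMap, hgh.apply_apply_eq_zero, map_zero]
    rfl

theorem InAdd.dual {X Y : ModuleCat.{u} R} (h : InAdd R X Y) :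
    InAdd Rᵐᵒᵖ (dual K X) (dual K Y) := by
  obtain ⟨n, a, b, h⟩ := h
  refine ⟨n, fun i => dualMap (b i), fun i => dualMap (a i), fun φ => dual_ext fun x => ?_⟩
  conv_rhs => rw [← h x, map_sum]
  have : ∀ ψ : Fin n → Precluster.dual K X,
      dualEval (∑ i, ψ i) x = ∑ i, dualEval (ψ i) x := fun ψ =>
    map_sum (AddMonoidHom.mk' (fun χ : Precluster.dual K X => dualEval χ x) fun _ _ => rfl) ψ _
  exact this _

/-! ### Duality exchanges reductions and coreductions -/

variable {f : R →+* S}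

theorem map_smul_of_algebraMap (hK : ∀ k, f (algebraMap K R k) = algebraMap K S k)
    {U : ModuleCat.{u} R} {W : ModuleCat.{u} S} (π : U →ₛₗ[f] W) (k : K) (x : U) :
    π (k • x) = k • π x := by
  rw [← algebraMap_smul_moduleCat, map_smulₛₗ, hK, algebraMap_smul_moduleCat]

/-- The dual of a reduction is a coreduction. -/
theorem IsReduction.exists_dual_isCoreduction
    (hK : ∀ k, f (algebraMap K R k) = algebraMap K S k) {U : ModuleCat.{u} R}
    {W : ModuleCat.{u} S} {π : U →ₛₗ[f] W} (hπ : IsReduction π) :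
    ∃ ι : dual K W →+ dual K U, (∀ φ x, dualEval (ι φ) x = dualEval φ (π x)) ∧
      IsCoreduction f.op ι := by
  let πK : U →ₗ[K] W :=
    { toFun := π, map_add' := map_add π, map_smul' := map_smul_of_algebraMap hK π }
  let ι : dual K W →+ dual K U :=
    { toFun := fun φ => dualMk (dualEval φ ∘ₗ πK), map_zero' := rfl, map_add' := fun _ _ => rfl }
  have hι : ∀ φ x, dualEval (ι φ) x = dualEval φ (π x) := fun φ x => rfl
  refine ⟨ι, hι, ⟨fun φ ψ h => dual_ext fun y => ?_, fun r φ => dual_ext fun x => ?_,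
    fun ψ hψ => ?_⟩⟩
  · obtain ⟨x, rfl⟩ := hπ.surjective y
    rw [← hι, ← hι, h]
  · rw [hι, dualEval_smul, dualEval_smul, hι, LinearMap.map_smulₛₗ π]
    rfl
  · obtain ⟨s, hs⟩ := πK.exists_rightInverse_of_surjective (LinearMap.range_eq_top.2 hπ.surjective)
    refine ⟨dualMk (dualEval ψ ∘ₗ s), dual_ext fun x => ?_⟩
    have hx : s (π x) - x ∈ (RingHom.ker f • ⊤ : Submodule R U) :=
      hπ.mem_of_map_eq_zero _ (by
        rw [map_sub, sub_eq_zero]; exact LinearMap.congr_fun hs (π x))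
    rw [hι]
    change dualEval ψ (s (π x)) = dualEval ψ x
    rw [← sub_eq_zero, ← map_sub]
    generalize s (π x) - x = z at hx ⊢
    induction hx using Submodule.smul_induction_on' with
    | smul r hr y _ =>
      have := hψ (MulOpposite.op r) (congrArg MulOpposite.op
        (RingHom.mem_ker.1 hr : f r = 0))
      exact congrArg (fun χ => dualEval χ y) this
    | add x _ y _ hx hy => rw [map_add, hx, hy, add_zero]

/-- In finite dimension the dual of a coreduction is a reduction. -/
theorem IsCoreduction.exists_dual_isReduction
    (hK : ∀ k, f (algebraMap K R k) = algebraMap K S k) {M : ModuleCat.{u} R}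
    {N : ModuleCat.{u} S} [Module.Finite K M] {ι : N →+ M} (hι : IsCoreduction f ι) :
    ∃ π : dual K M →ₛₗ[f.op] dual K N, IsReduction π := by
  let ιK : N →ₗ[K] M :=
    { toFun := ι
      map_add' := map_add ι
      map_smul' := fun k n => by
        rw [← algebraMap_smul_moduleCat, ← hK, hι.map_smul, algebraMap_smul_moduleCat,
          RingHom.id_apply] }
  let π : dual K M →ₛₗ[f.op] dual K N :=
    { toFun := fun φ => dualMk (dualEval φ ∘ₗ ιK)
      map_add' := fun _ _ => rfl
      map_smul' := fun r φ => dual_ext fun x => congrArg (dualEval φ) (hι.map_smul r.unop x).symm }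
  refine ⟨π, ⟨fun φ => ?_, fun φ hφ => mem_of_forall_dualEval_eq_zero _ _ fun m hm => ?_⟩⟩
  · obtain ⟨s, hs⟩ := ιK.exists_leftInverse_of_injective (LinearMap.ker_eq_bot.2 hι.injective)
    exact ⟨dualMk (dualEval φ ∘ₗ s), dual_ext fun x =>
      congrArg (dualEval φ) (LinearMap.congr_fun hs x)⟩
  · obtain ⟨n, rfl⟩ := hι.mem_range m fun r hr => eq_zero_of_forall_dualEval (K := K) fun ψ =>
      hm (MulOpposite.op r • ψ) (Submodule.smul_mem_smul
        ((RingHom.mem_ker).2 (congrArg MulOpposite.op hr)) trivial)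
    exact congrArg (fun χ => dualEval χ n) hφ

/-! ### Duality exchanges projectives and injectives -/

/-- The adjunction `Hom(F, D X) → Hom(X, D F)`. -/
noncomputable def dualFlip {F : ModuleCat.{u} Rᵐᵒᵖ} {X : ModuleCat.{u} R} (g : F →ₗ[Rᵐᵒᵖ] dual K X) :
    X →ₗ[R] ofOpOp (dual K F) where
  toFun x := dualMk (N := F)
    { toFun := fun y => dualEval (g y) x
      map_add' := fun y z => by rw [map_add, dualEval_add]
      map_smul' := fun k y => by
        rw [← algebraMap_smul_moduleCat, map_smul, dualEval_smul, MulOpposite.algebraMap_apply,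
          MulOpposite.unop_op, algebraMap_smul_moduleCat, map_smul, RingHom.id_apply] }
  map_add' x x' := dual_ext (N := F) fun y => map_add (dualEval (g y)) x x'
  map_smul' r x := dual_ext (N := F) fun y =>
    (congrArg (fun χ => dualEval χ x) (map_smul g (MulOpposite.op r) y)).symm

/-- The adjunction `Hom(X, D F) → Hom(F, D X)`. -/
noncomputable def dualUnflip {F : ModuleCat.{u} Rᵐᵒᵖ} {X : ModuleCat.{u} R} (g : X →ₗ[R] ofOpOp (dual K F)) :
    F →ₗ[Rᵐᵒᵖ] dual K X where
  toFun y := dualMk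
    { toFun := fun x => dualEval (N := F) (g x) y
      map_add' := fun x z => by rw [map_add]; rfl
      map_smul' := fun k x => by
        rw [← algebraMap_smul_moduleCat, map_smul, RingHom.id_apply]
        refine Eq.trans (b := dualEval (N := F) (g x) (algebraMap K Rᵐᵒᵖ k • y)) rfl ?_
        rw [algebraMap_smul_moduleCat, map_smul] }
  map_add' y y' := dual_ext fun x => map_add (dualEval (N := F) (g x)) y y'
  map_smul' r y := dual_ext fun x => by
    refine Eq.trans ?_ (congrArg (fun χ => dualEval (N := F) χ y) (map_smul g r.unop x).symm)
    rfl

theorem injective_dual_of_projective (F : ModuleCat.{u} Rᵐᵒᵖ) [Module.Projective Rᵐᵒᵖ F] :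
    Module.Injective.{u, u} R (ofOpOp (dual K F)) where
  out X Y _ _ _ _ i hi g := by
    obtain ⟨G, hG⟩ := Module.projective_lifting_property
      (dualMap (K := K) (X := ModuleCat.of R X) (Y := ModuleCat.of R Y) i)
      (dualUnflip (X := ModuleCat.of R X) g) (dualMap_surjective hi)
    exact ⟨dualFlip (X := ModuleCat.of R Y) G, fun x => dual_ext (N := F) fun y =>
      congrArg (fun χ => dualEval χ x) (LinearMap.congr_fun hG y)⟩

theorem finite_ofOpOp_dual (F : ModuleCat.{u} Rᵐᵒᵖ) [Module.Finite K F] :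
    Module.Finite R (ofOpOp (dual K F)) := by
  have := finite_dual F (K := K)
  obtain ⟨n, g, hg⟩ := Module.Finite.exists_fin' Rᵐᵒᵖᵐᵒᵖ (dual K F)
  let g' : (Fin n → R) →ₗ[R] ofOpOp (dual K F) :=
    { toFun := fun v => g fun i => RingEquiv.opOp R (v i)
      map_add' := fun v w => map_add g (fun i => RingEquiv.opOp R (v i))
        fun i => RingEquiv.opOp R (w i)
      map_smul' := fun r v => (congrArg g (funext fun i => map_mul (RingEquiv.opOp R) r (v i))).trans
        (map_smul g (RingEquiv.opOp R r) fun i => RingEquiv.opOp R (v i)) }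
  exact Module.Finite.of_surjective g' fun φ => by
    obtain ⟨v, rfl⟩ := hg φ
    exact ⟨fun i => (RingEquiv.opOp R).symm (v i), rfl⟩

theorem dualFlip_injective {F : ModuleCat.{u} Rᵐᵒᵖ} {X : ModuleCat.{u} R}
    {g : F →ₗ[Rᵐᵒᵖ] dual K X} (hg : Function.Surjective g) :
    Function.Injective (dualFlip g) := by
  rw [← LinearMap.ker_eq_bot, LinearMap.ker_eq_bot']
  intro x hx
  refine eq_zero_of_forall_dualEval (K := K) fun φ => ?_
  obtain ⟨y, rfl⟩ := hg φ
  exact congrArg (fun χ => dualEval (N := F) χ y) hx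

instance [Module.Finite K R] : Module.Finite K Rᵐᵒᵖ :=
  Module.Finite.equiv (MulOpposite.opLinearEquiv K)

theorem exists_isInjectiveEnvelope (K : Type u) [Field K] [Algebra K R] [Module.Finite K R]
    (X : ModuleCat.{u} R) [Module.Finite R X] :
    ∃ (I : ModuleCat.{u} R) (j : X →ₗ[R] I), IsInjectiveEnvelope j := by
  have := IsArtinianRing.of_finite K R
  have : IsNoetherianRing R := IsNoetherianRing.of_finite K R
  have := finite_of_finite (K := K) X
  have := finite_dual (K := K) X
  obtain ⟨n, g, hg⟩ := Module.Finite.exists_fin' Rᵐᵒᵖ (dual K X)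
  let F := ModuleCat.of Rᵐᵒᵖ (Fin n → Rᵐᵒᵖ)
  have : Module.Projective Rᵐᵒᵖ F := inferInstanceAs (Module.Projective Rᵐᵒᵖ (Fin n → Rᵐᵒᵖ))
  have : Module.Finite Rᵐᵒᵖ F := inferInstanceAs (Module.Finite Rᵐᵒᵖ (Fin n → Rᵐᵒᵖ))
  have := finite_of_finite (K := K) F
  have := finite_ofOpOp_dual (K := K) F
  have := injective_dual_of_projective (K := K) F
  exact exists_isInjectiveEnvelope_of_embedding (dualFlip (F := F) g) (dualFlip_injective hg)

theorem exists_dualEval_eq {N : ModuleCat.{u} R} [Module.Finite K N]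
    (Λ : Module.Dual K N →ₗ[K] K) : ∃ x, ∀ φ : Module.Dual K N, φ x = Λ φ := by
  obtain ⟨x, rfl⟩ := (Module.evalEquiv K N).surjective Λ
  exact ⟨x, fun φ => rfl⟩

/-- The dual of an injective module `I` is projective if there is a surjection `g : F → D I` from a
finite-dimensional projective module: `g` corresponds to an embedding `I → D F`, and a retraction of
the latter transposes to a section of `g`. -/
theorem projective_dual_of_surjective {I : ModuleCat.{u} R} (hI : Module.Injective.{u, u} R I)
    {F : ModuleCat.{u} Rᵐᵒᵖ} [Module.Projective Rᵐᵒᵖ F] [Module.Finite K F]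
    (g : F →ₗ[Rᵐᵒᵖ] dual K I) (hg : Function.Surjective g) :
    Module.Projective Rᵐᵒᵖ (dual K I) := by
  obtain ⟨ρ, hρ⟩ := hI.out (dualFlip g) (dualFlip_injective hg) LinearMap.id
  let m : Module.Dual K F → ofOpOp (dual K F) := fun ψ => dualMk (N := F) ψ
  have hm : ∀ (r : Rᵐᵒᵖ) ψ,
      m (dualEval (N := F) (MulOpposite.op r • dualMk (N := F) ψ)) = r.unop • m ψ :=
    fun r ψ => rfl
  have hmK : ∀ (k : K) ψ, m (k • ψ) = algebraMap K R k • m ψ := fun k ψ =>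
    dual_ext (N := F) fun y =>
      (map_smul ψ k y).symm.trans (congrArg ψ (algebraMap_smul_moduleCat (K := K) k y).symm)
  have key : ∀ φ : dual K I, ∃ y : F, ∀ ψ : Module.Dual K F, ψ y = dualEval φ (ρ (m ψ)) :=
    fun φ => exists_dualEval_eq
      { toFun := fun ψ => dualEval φ (ρ (m ψ))
        map_add' := fun a b => (congrArg (dualEval φ) (map_add ρ (m a) (m b))).trans
          (map_add _ _ _)
        map_smul' := fun k a => by
          rw [hmK, map_smul, algebraMap_smul_moduleCat, map_smul, RingHom.id_apply] }
  choose s hs using key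
  have hF : ∀ y y' : F, (∀ ψ : Module.Dual K F, ψ y = ψ y') → y = y' := fun y y' h => by
    rw [← sub_eq_zero]
    exact (Module.forall_dual_apply_eq_zero_iff K _).1 fun ψ => by rw [map_sub, h, sub_self]
  let s' : dual K I →ₗ[Rᵐᵒᵖ] F :=
    { toFun := s
      map_add' := fun φ χ => hF _ _ fun ψ => by rw [map_add, hs, hs, hs, dualEval_add]
      map_smul' := fun r φ => hF _ _ fun ψ => by
        rw [hs, dualEval_smul, ← map_smul, RingHom.id_apply, ← hm]
        exact (hs φ (dualEval (N := F) (MulOpposite.op r • dualMk (N := F) ψ))).symm }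
  refine Module.Projective.of_split s' g
    (LinearMap.ext fun φ => dual_ext fun x => ?_)
  refine (hs φ (dualEval (N := F) (dualFlip g x))).trans ?_
  exact congrArg (dualEval φ) (hρ x)

theorem projective_dual_of_injective [Module.Finite K R] (I : ModuleCat.{u} R)
    [Module.Finite R I] (hI : Module.Injective.{u, u} R I) :
    Module.Projective Rᵐᵒᵖ (dual K I) := by
  have := finite_of_finite (K := K) I
  have := finite_dual (K := K) I
  obtain ⟨n, g, hg⟩ := Module.Finite.exists_fin' Rᵐᵒᵖ (dual K I)
  let F := ModuleCat.of Rᵐᵒᵖ (Fin n → Rᵐᵒᵖ)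
  have : Module.Projective Rᵐᵒᵖ F := inferInstanceAs (Module.Projective Rᵐᵒᵖ (Fin n → Rᵐᵒᵖ))
  have : Module.Finite Rᵐᵒᵖ F := inferInstanceAs (Module.Finite Rᵐᵒᵖ (Fin n → Rᵐᵒᵖ))
  have := finite_of_finite (K := K) F
  exact projective_dual_of_surjective hI (F := F) g hg

/-- The dual of an injective envelope is a projective cover. -/
theorem IsInjectiveEnvelope.isProjectiveCover_dualMap [Module.Finite K R] {N I : ModuleCat.{u} R}
    {j : N →ₗ[R] I} (hj : IsInjectiveEnvelope j) :
    IsProjectiveCover (dualMap (K := K) j) := by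
  have := hj.finite
  have := finite_of_finite (K := K) I
  refine ⟨finite_dual I, projective_dual_of_injective I hj.isInjective,
    dualMap_surjective hj.injective, fun L hL => ?_⟩
  let A : Submodule R I :=
    { carrier := {x | ∀ l ∈ L, dualEval l x = 0}
      add_mem' := fun hx hy l hl => by rw [map_add, hx l hl, hy l hl, add_zero]
      zero_mem' := fun l _ => map_zero _
      smul_mem' := fun r x hx l hl => hx (MulOpposite.op r • l) (L.smul_mem _ hl) }
  have hA : A = ⊥ := by
    refine hj.essential A (eq_bot_iff.2 ?_)
    rintro _ ⟨hx, n, rfl⟩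
    refine (Submodule.mem_bot R).2 (eq_zero_of_forall_dualEval (K := K) fun φ => ?_)
    obtain ⟨l, hl, k, hk, rfl⟩ := Submodule.mem_sup.1 (hL ▸ Submodule.mem_top : φ ∈ L ⊔ _)
    rw [dualEval_add, hx l hl, zero_add]
    exact congrArg (fun χ => dualEval χ n) hk
  refine eq_top_iff.2 fun φ _ => mem_of_forall_dualEval_eq_zero L φ fun x hx => ?_
  have hx' : x ∈ A := hx
  rw [hA, Submodule.mem_bot] at hx'
  rw [hx', map_zero]

end Dual

/-! ### Vanishing of the first extension group -/

section Ext

variable {R : Type u} [Ring R]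

open Abelian

/-- If `Ext¹(X, Y) = 0`, then maps to `Y` extend along inclusions with cokernel `X`. -/
theorem exists_extend_of_ext {A B X Y : ModuleCat.{u} R} (h : Subsingleton (Ext X Y 1))
    {i : A →ₗ[R] B} {p : B →ₗ[R] X} (hi : Function.Injective i) (hip : Function.Exact i p)
    (hp : Function.Surjective p) (g : A →ₗ[R] Y) : ∃ G : B →ₗ[R] Y, ∀ x, G (i x) = g x := by
  let T : ShortComplex (ModuleCat.{u} R) := ModuleCat.shortComplexOfCompEqZero i p hip.linearMap_comp_eq_zero
  have hT : T.ShortExact := ModuleCat.shortComplex_shortExact T hip hi hp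
  obtain ⟨x, hx⟩ := Ext.contravariant_sequence_exact₁ hT Y (Ext.mk₀ (ModuleCat.ofHom g))
    (add_zero 1) (h.elim _ _)
  obtain ⟨G, rfl⟩ := Ext.mk₀_bijective _ _ |>.2 x
  rw [Ext.mk₀_comp_mk₀] at hx
  have := (Ext.mk₀_bijective _ _).1 hx
  exact ⟨G.hom, fun y => congrArg (fun k => k.hom y) this⟩

/-- If `Ext¹(X, Y) = 0`, then maps from `X` lift along surjections with kernel `Y`. -/
theorem exists_lift_of_ext {B C X Y : ModuleCat.{u} R} (h : Subsingleton (Ext X Y 1))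
    {i : Y →ₗ[R] B} {p : B →ₗ[R] C} (hi : Function.Injective i) (hip : Function.Exact i p)
    (hp : Function.Surjective p) (g : X →ₗ[R] C) : ∃ G : X →ₗ[R] B, ∀ x, p (G x) = g x := by
  let T : ShortComplex (ModuleCat.{u} R) := ModuleCat.shortComplexOfCompEqZero i p hip.linearMap_comp_eq_zero
  have hT : T.ShortExact := ModuleCat.shortComplex_shortExact T hip hi hp
  obtain ⟨x, hx⟩ := Ext.covariant_sequence_exact₃ X hT (Ext.mk₀ (ModuleCat.ofHom g))
    (zero_add 1) (h.elim _ _)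
  obtain ⟨G, rfl⟩ := Ext.mk₀_bijective _ _ |>.2 x
  rw [Ext.mk₀_comp_mk₀] at hx
  have := (Ext.mk₀_bijective _ _).1 hx
  exact ⟨G.hom, fun y => congrArg (fun k => k.hom y) this⟩

/-- A converse of `exists_extend_of_ext`. -/
theorem subsingleton_ext_of_forall_extend {X Y : ModuleCat.{u} R}
    (h : ∀ (A B : ModuleCat.{u} R) (i : A →ₗ[R] B) (p : B →ₗ[R] X), Function.Injective i →
      Function.Exact i p → Function.Surjective p → ∀ g : A →ₗ[R] Y,
        ∃ G : B →ₗ[R] Y, ∀ x, G (i x) = g x) : Subsingleton (Ext X Y 1) := by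
  refine subsingleton_of_forall_eq 0 fun ξ => ?_
  let T := X.projectiveShortComplex
  have hT : T.ShortExact := X.shortExact_projectiveShortComplex
  have : Projective T.X₂ := ModuleCat.projective_of_free
    (Module.Free.chooseBasis R X.projectiveShortComplex.X₂)
  obtain ⟨y, rfl⟩ := Ext.contravariant_sequence_exact₃ hT Y ξ (Ext.eq_zero_of_projective _)
    (add_zero 1)
  obtain ⟨g, rfl⟩ := Ext.mk₀_bijective _ _ |>.2 y
  obtain ⟨G, hG⟩ := h T.X₁ T.X₂ T.f.hom T.g.hom hT.moduleCat_injective_f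
    ((ShortComplex.ShortExact.moduleCat_exact_iff_function_exact T).1 hT.exact) hT.moduleCat_surjective_g g.hom
  have : g = T.f ≫ ModuleCat.ofHom G := by
    ext x
    exact (hG x).symm
  rw [this, ← Ext.mk₀_comp_mk₀, hT.extClass_comp_assoc]

theorem subsingleton_ext_of_inAdd {M X Y : ModuleCat.{u} R} (h : Subsingleton (Ext M M 1))
    (hX : InAdd R X M) (hY : InAdd R Y M) : Subsingleton (Ext X Y 1) := by
  obtain ⟨n, a, b, hab⟩ := hX
  obtain ⟨m, c, d, hcd⟩ := hY
  refine subsingleton_of_forall_eq 0 fun ξ => ?_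
  have hidX : 𝟙 X = ∑ i, ModuleCat.ofHom (a i) ≫ ModuleCat.ofHom (b i) := by
    ext x
    simp [ModuleCat.hom_sum, LinearMap.sum_apply, hab]
  have hidY : 𝟙 Y = ∑ i, ModuleCat.ofHom (c i) ≫ ModuleCat.ofHom (d i) := by
    ext x
    simp [ModuleCat.hom_sum, LinearMap.sum_apply, hcd]
  have h1 : ∀ η : Ext M Y 1, η = 0 := fun η => by
    rw [← Ext.comp_mk₀_id η, hidY, Ext.mk₀_sum, Ext.comp_sum]
    refine Finset.sum_eq_zero fun i _ => ?_
    rw [← Ext.mk₀_comp_mk₀, ← Ext.comp_assoc_of_third_deg_zero,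
      Subsingleton.elim (η.comp (Ext.mk₀ (ModuleCat.ofHom (c i))) (add_zero 1)) 0, Ext.zero_comp]
  rw [← Ext.mk₀_id_comp ξ, hidX, Ext.mk₀_sum, Ext.sum_comp]
  refine Finset.sum_eq_zero fun i _ => ?_
  rw [← Ext.mk₀_comp_mk₀, Ext.comp_assoc_of_second_deg_zero,
    h1 ((Ext.mk₀ (ModuleCat.ofHom (b i))).comp ξ (zero_add 1)), Ext.comp_zero]

end Ext

/-! ### Restriction of scalars and the double opposite ring -/

section Transport

variable {R S : Type u} [Ring R] [Ring S] {f : R →+* S}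

theorem InAdd.restrictScalars (f : R →+* S) {X Y : ModuleCat.{u} S} (h : InAdd S X Y) :
    InAdd R ((ModuleCat.restrictScalars f).obj X) ((ModuleCat.restrictScalars f).obj Y) := by
  obtain ⟨n, a, b, h⟩ := h
  exact ⟨n, fun i => ((ModuleCat.restrictScalars f).map (ModuleCat.ofHom (a i))).hom,
    fun i => ((ModuleCat.restrictScalars f).map (ModuleCat.ofHom (b i))).hom, h⟩

theorem InAdd.ofOpOp {X Y : ModuleCat.{u} Rᵐᵒᵖᵐᵒᵖ} (h : InAdd Rᵐᵒᵖᵐᵒᵖ X Y) :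
    InAdd R (ofOpOp X) (ofOpOp Y) :=
  h.restrictScalars (RingEquiv.opOp R).toRingHom

theorem IsCoreduction.ofOpOp {N : ModuleCat.{u} Sᵐᵒᵖᵐᵒᵖ} {M : ModuleCat.{u} Rᵐᵒᵖᵐᵒᵖ} {ι : N →+ M}
    (h : IsCoreduction f.op.op ι) :
    ∃ ι' : ofOpOp N →+ ofOpOp M, IsCoreduction f ι' :=
  ⟨(ι : N →+ M), ⟨h.injective, fun r n => h.map_smul (.op (.op r)) n, fun m hm =>
    h.mem_range m fun r hr => hm r.unop.unop
      (congrArg (fun s => MulOpposite.unop (MulOpposite.unop s)) hr)⟩⟩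

theorem IsReduction.ofOpOp {N : ModuleCat.{u} Sᵐᵒᵖᵐᵒᵖ} {M : ModuleCat.{u} Rᵐᵒᵖᵐᵒᵖ}
    {π : M →ₛₗ[f.op.op] N} (h : IsReduction π) :
    ∃ π' : ofOpOp M →ₛₗ[f] ofOpOp N, IsReduction π' := by
  let π' : Precluster.ofOpOp M →ₛₗ[f] Precluster.ofOpOp N :=
    { toFun := π
      map_add' := map_add π
      map_smul' := fun r x => π.map_smulₛₗ (.op (.op r)) x }
  refine ⟨π', h.surjective, fun x hx₀ => ?_⟩
  have hx := h.mem_of_map_eq_zero x hx₀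
  clear hx₀
  induction hx using Submodule.smul_induction_on' with
  | smul r hr y _ =>
    exact Submodule.smul_mem_smul (r := r.unop.unop) (n := (y : Precluster.ofOpOp M))
      (RingHom.mem_ker.2 (congrArg (fun s => MulOpposite.unop (MulOpposite.unop s))
        (RingHom.mem_ker.1 hr : f.op.op r = 0))) trivial
  | add x _ y _ hx hy => exact Submodule.add_mem _ hx hy

theorem IsReduction.comp_equiv {Q Q₁ Q' : Type*} [AddCommGroup Q] [Module R Q] [AddCommGroup Q₁]
    [Module R Q₁] [AddCommGroup Q'] [Module S Q'] {π : Q →ₛₗ[f] Q'} (h : IsReduction π)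
    (e : Q₁ ≃ₗ[R] Q) : IsReduction (π.comp (e : Q₁ →ₗ[R] Q)) := by
  refine ⟨h.surjective.comp e.surjective, fun x hx => ?_⟩
  have := Submodule.mem_map_of_mem (f := (e.symm : Q →ₗ[R] Q₁)) (h.mem_of_map_eq_zero _ hx)
  rw [Submodule.map_smul''] at this
  have h' := Submodule.smul_mono le_rfl le_top this
  simpa using h'

theorem finite_of_finite_restrictScalars (hf : Function.Surjective f) (N : ModuleCat.{u} S)
    (h : Module.Finite R ((ModuleCat.restrictScalars f).obj N)) : Module.Finite S N :=
  haveI : RingHomSurjective f := ⟨hf⟩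
  let g : (ModuleCat.restrictScalars f).obj N →ₛₗ[f] N :=
    { toFun := fun x => x, map_add' := fun _ _ => rfl, map_smul' := fun _ _ => rfl }
  Module.Finite.of_surjective g fun x => ⟨x, rfl⟩

theorem isReduction_self (hf : Function.Surjective f) :
    ∃ π : R →ₛₗ[f] S, IsReduction π := by
  let π : R →ₛₗ[f] S := { toFun := f, map_add' := map_add f, map_smul' := map_mul f }
  refine ⟨π, hf, fun x hx => ?_⟩
  rw [← mul_one x]
  exact Submodule.smul_mem_smul (RingHom.mem_ker.2 hx) trivial

theorem isReduction_self_op (hf : Function.Surjective f) :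
    ∃ π : ModuleCat.of Rᵐᵒᵖ R →ₛₗ[f.op] ModuleCat.of Sᵐᵒᵖ S, IsReduction π := by
  let π : ModuleCat.of Rᵐᵒᵖ R →ₛₗ[f.op] ModuleCat.of Sᵐᵒᵖ S :=
    { toFun := f, map_add' := map_add f, map_smul' := fun r x => map_mul f x r.unop }
  refine ⟨π, hf, fun x hx => ?_⟩
  have : x = MulOpposite.op (x : R) • ((1 : R) : ModuleCat.of Rᵐᵒᵖ R) := (one_mul (x : R)).symm
  rw [this]
  exact Submodule.smul_mem_smul (RingHom.mem_ker.2 (congrArg MulOpposite.op hx)) trivial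

/-- An additive map of `S`-modules is `S`-linear if it is compatible with the action of `R`. -/
def linearOfSurjective (hf : Function.Surjective f) {X Y : Type*} [AddCommGroup X] [Module S X]
    [AddCommGroup Y] [Module S Y] (g : X →+ Y) (hg : ∀ r x, g (f r • x) = f r • g x) :
    X →ₗ[S] Y where
  toFun := g
  map_add' := map_add g
  map_smul' s x := by
    obtain ⟨r, rfl⟩ := hf s
    exact hg r x

end Transport

/-! ### Modules over the quotient that lie in `add M` -/

section Membership

variable {R S : Type u} [Ring R] [Ring S] {f : R →+* S} {M : ModuleCat.{u} R}
  {N X : ModuleCat.{u} S}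

/-- If an `S`-module lies in `add M` over `R`, it lies in `add (S ⊗ M)` over `S`. -/
theorem IsReduction.inAdd (hf : Function.Surjective f) {π : M →ₛₗ[f] N} (hπ : IsReduction π)
    (hX : InAdd R ((ModuleCat.restrictScalars f).obj X) M) : InAdd S X N := by
  obtain ⟨n, a, b, h⟩ := hX
  have key : ∀ i, ∃ b' : N →ₗ[S] X, ∀ m, b' (π m) = b i m := fun i =>
    hπ.exists_lift hf ({ toFun := fun m => b i m, map_add' := map_add (b i),
                         map_smul' := fun r m => (b i).map_smul r m } : M →ₛₗ[f] X)
  choose b' hb' using key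
  refine ⟨n, fun i => linearOfSurjective hf (π.toAddMonoidHom.comp (a i).toAddMonoidHom)
    fun r x => ?_, b', fun x => ?_⟩
  · exact (congrArg π ((a i).map_smul r x)).trans (π.map_smulₛₗ r _)
  · refine Eq.trans (Finset.sum_congr rfl fun i _ => hb' i (a i x)) (h x)

/-- If an `S`-module lies in `add M` over `R`, it lies in `add Hom_R(S, M)` over `S`. -/
theorem IsCoreduction.inAdd (hf : Function.Surjective f) {ι : N →+ M} (hι : IsCoreduction f ι)
    (hX : InAdd R ((ModuleCat.restrictScalars f).obj X) M) : InAdd S X N := by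
  obtain ⟨n, a, b, h⟩ := hX
  have key : ∀ i, ∃ a' : X →ₗ[S] N, ∀ x, ι (a' x) = a i x := fun i =>
    hι.exists_lift_addMonoidHom hf (AddMonoidHom.mk' (fun x : X => a i x) (map_add (a i)))
      fun r x => (a i).map_smul r x
  choose a' ha' using key
  refine ⟨n, a', fun i => linearOfSurjective hf
    ((AddMonoidHom.mk' (fun x : M => (b i x : X)) (map_add (b i))).comp ι) fun r x => ?_,
    fun x => ?_⟩
  · exact (congrArg (b i) (hι.map_smul r x)).trans ((b i).map_smul r _)
  · refine Eq.trans (Finset.sum_congr rfl fun i _ => ?_) (h x)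
    exact congrArg (b i) (ha' i x)

theorem IsReduction.inAdd_restrictScalars (hf : Function.Surjective f) {U : ModuleCat.{u} R}
    {W : ModuleCat.{u} S} {π : U →ₛₗ[f] W} (hπ : IsReduction π)
    (h : InAdd R ((ModuleCat.restrictScalars f).obj (tensorObj f U)) M) :
    InAdd R ((ModuleCat.restrictScalars f).obj W) M := by
  obtain ⟨ρ, hρ⟩ := exists_isReduction_tensorObj hf U
  obtain ⟨e⟩ := hπ.exists_equiv hf hρ
  exact ((InAdd.of_equiv e).restrictScalars f).trans h

theorem IsCoreduction.inAdd_restrictScalars (hf : Function.Surjective f) {U : ModuleCat.{u} R}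
    {W : ModuleCat.{u} S} {ι : W →+ U} (hι : IsCoreduction f ι)
    (h : InAdd R ((ModuleCat.restrictScalars f).obj ((ModuleCat.coextendScalars f).obj U)) M) :
    InAdd R ((ModuleCat.restrictScalars f).obj W) M := by
  obtain ⟨ρ, hρ⟩ := exists_isCoreduction_coextendScalars hf U
  obtain ⟨e⟩ := hρ.exists_equiv hf hι
  exact ((InAdd.of_equiv e).restrictScalars f).trans h

end Membership

/-! ### Vanishing of `Tor₁` -/

section Tor

variable {K : Type u} [Field K] {R S : Type u} [Ring R] [Algebra K R] [Ring S] {f : R →+* S}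

/-- If maps `S → L` lift to `J`, as they do when `Ext¹_R(S, M) = 0`, then the dual of the injective
presentation `0 → M → J → L → 0` satisfies `(D J) I ∩ Ker (D j) = Ker (D j) I`. -/
theorem mem_smul_ker_dualMap {M J L : ModuleCat.{u} R} [Module.Finite K J] {j : M →ₗ[R] J}
    {c : J →ₗ[R] L} (hjc : Function.Exact j c)
    (hlift : ∀ y : L, (∀ r, f r = 0 → r • y = 0) →
      ∃ x : J, (∀ r, f r = 0 → r • x = 0) ∧ c x = y)
    (φ : dual K J) (hφ : dualMap j φ = 0)
    (hφI : φ ∈ (RingHom.ker f.op • ⊤ : Submodule Rᵐᵒᵖ (dual K J))) :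
    φ ∈ RingHom.ker f.op • LinearMap.ker (dualMap (K := K) j) := by
  refine mem_of_forall_dualEval_eq_zero _ _ fun z hz => ?_
  have hcz : ∀ r, f r = 0 → r • c z = 0 := fun r hr =>
    eq_zero_of_forall_dualEval (K := K) fun ψ => by
      rw [← map_smul]
      refine hz (MulOpposite.op r • dualMap c ψ) (Submodule.smul_mem_smul
        (RingHom.mem_ker.2 (congrArg MulOpposite.op hr)) ?_)
      refine LinearMap.mem_ker.2 (dual_ext fun m => ?_)
      rw [dualEval_dualMap, dualEval_dualMap, hjc.apply_apply_eq_zero, map_zero]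
      rfl
  obtain ⟨z', hz', hcz'⟩ := hlift (c z) hcz
  obtain ⟨m, hm⟩ := (hjc (z - z')).1 (by rw [map_sub, hcz', sub_self])
  have h1 : dualEval φ (z - z') = 0 := by
    rw [← hm]
    exact congrArg (fun χ => dualEval χ m) hφ
  have h2 : dualEval φ z' = 0 := by
    clear hφ h1
    induction hφI using Submodule.smul_induction_on' with
    | smul r hr ψ _ =>
      rw [dualEval_smul, hz' r.unop (congrArg MulOpposite.unop (RingHom.mem_ker.1 hr : f.op r = 0)),
        map_zero]
    | add a _ b _ ha hb => rw [dualEval_add, ha, hb, add_zero]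
  rwa [map_sub, h2, sub_zero] at h1

variable [Algebra K S]

theorem exists_isCoreduction_dualRegular (hf : Function.Surjective f)
    (hK : ∀ k, f (algebraMap K R k) = algebraMap K S k) :
    ∃ ι : dualRegular K S →+ dualRegular K R, IsCoreduction f ι := by
  obtain ⟨π, hπ⟩ := isReduction_self_op hf
  obtain ⟨ι, -, hι⟩ := hπ.exists_dual_isCoreduction (K := K) fun k => congrArg MulOpposite.op (hK k)
  exact hι.ofOpOp

/-- If maps from `Ker p` to `D S` extend to `Q`, as they do when `Ext¹_R(M, D S) = 0`, then
`I Q ∩ Ker p = I Ker p`: a functional on `Q` that vanishes on `I Ker p` defines a map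
`Ker p → D S`, and an extension of it to `Q` kills `I Q`. -/
theorem mem_smul_ker_of_forall_extend (hf : Function.Surjective f)
    (hK : ∀ k, f (algebraMap K R k) = algebraMap K S k) {Q M : ModuleCat.{u} R} (p : Q →ₗ[R] M)
    (hext : ∀ g : LinearMap.ker p →ₛₗ[f] dualRegular K S,
      ∃ G : Q →ₛₗ[f] dualRegular K S, ∀ y : LinearMap.ker p, G y = g y)
    (x : Q) (hx : p x = 0) (hxI : x ∈ (RingHom.ker f • ⊤ : Submodule R Q)) :
    x ∈ RingHom.ker f • LinearMap.ker p := by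
  by_contra hcon
  obtain ⟨l, hlx, hl⟩ := ((RingHom.ker f • LinearMap.ker p).restrictScalars K
    ).exists_dual_map_eq_bot_of_notMem (x := x) hcon inferInstance
  have hl0 : ∀ z ∈ RingHom.ker f • LinearMap.ker p, l z = 0 := fun z hz => by
    have : l z ∈ ((RingHom.ker f • LinearMap.ker p).restrictScalars K).map l := ⟨z, hz, rfl⟩
    rwa [hl] at this
  let ψ : LinearMap.ker p →ₗ[R] dualRegular K R :=
    dualFlip (K := K) (F := ModuleCat.of Rᵐᵒᵖ R) (X := ModuleCat.of R (LinearMap.ker p))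
      { toFun := fun r => dualMk (N := ModuleCat.of R (LinearMap.ker p))
          { toFun := fun y => l ((r : R) • (y : Q))
            map_add' := fun y z => by
              rw [← map_add, ← smul_add]
              rfl
            map_smul' := fun k y => by
              refine (congrArg l ?_).trans (map_smul l k ((r : R) • (y : Q)))
              change (r : R) • (algebraMap K R k • (y : Q)) = k • (r : R) • (y : Q)
              rw [← algebraMap_smul_moduleCat, smul_smul, ← Algebra.commutes, mul_smul] }
        map_add' := fun r s => dual_ext (N := ModuleCat.of R (LinearMap.ker p)) fun y => by
          refine Eq.trans (congrArg l (add_smul (r : R) (s : R) (Subtype.val y))) (map_add _ _ _)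
        map_smul' := fun s r => dual_ext (N := ModuleCat.of R (LinearMap.ker p)) fun y =>
          congrArg l (mul_smul (r : R) s.unop (Subtype.val y)) }
  have hψ : ∀ (y : LinearMap.ker p) (r : R),
      dualEval (N := ModuleCat.of Rᵐᵒᵖ R) (ψ y) r = l (r • (y : Q)) := fun y r => rfl
  obtain ⟨ι, hι⟩ := exists_isCoreduction_dualRegular hf hK
  obtain ⟨g, hg⟩ := hι.exists_lift ψ fun r hr y => by
    refine dual_ext (N := ModuleCat.of Rᵐᵒᵖ R) fun s => ?_
    refine Eq.trans (b := l (((s : R) * r) • (y : Q))) ?_ (hl0 _ ?_)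
    · exact hψ y ((s : R) * r)
    · refine Submodule.smul_mem_smul (RingHom.mem_ker.2 ?_) y.2
      rw [map_mul, hr, mul_zero]
  obtain ⟨G, hG⟩ := hext g
  have h0 : ψ ⟨x, hx⟩ = 0 := by
    rw [← hg, ← hG, map_eq_zero_of_mem_smul G hxI, map_zero]
  refine hlx ?_
  rw [← one_smul R x]
  exact (hψ ⟨x, hx⟩ 1).symm.trans (congrArg (fun χ => dualEval (N := ModuleCat.of Rᵐᵒᵖ R) χ
    (1 : R)) h0)

end Tor

/-! ### Minimal presentations behind `τ₂` and `τ₂⁻` -/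

section Unpack

variable {R : Type u} [Ring R]

theorem IsProjectiveCover.comp_equiv {P M N : Type u} [AddCommGroup P] [Module R P]
    [AddCommGroup M] [Module R M] [AddCommGroup N] [Module R N] {p : P →ₗ[R] M}
    (hp : IsProjectiveCover p) (e : M ≃ₗ[R] N) :
    IsProjectiveCover ((e : M →ₗ[R] N) ∘ₗ p) where
  finite := hp.finite
  projective := hp.projective
  surjective := e.surjective.comp hp.surjective
  superfluous := by
    rw [LinearEquiv.ker_comp]
    exact hp.superfluous

theorem IsInjectiveEnvelope.comp_equiv {M N I : Type u} [AddCommGroup I] [Module R I]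
    [AddCommGroup M] [Module R M] [AddCommGroup N] [Module R N] {j : N →ₗ[R] I}
    (hj : IsInjectiveEnvelope j) (e : M ≃ₗ[R] N) :
    IsInjectiveEnvelope (j ∘ₗ (e : M →ₗ[R] N)) where
  finite := hj.finite
  isInjective := hj.isInjective
  injective := hj.injective.comp e.injective
  essential := by
    rw [LinearEquiv.range_comp]
    exact hj.essential

theorem isMinPres_of_isProjectiveCover {Q₂ Q₁ Q₀ L M : Type u} [AddCommGroup Q₂] [Module R Q₂]
    [AddCommGroup Q₁] [Module R Q₁] [AddCommGroup Q₀] [Module R Q₀] [AddCommGroup L] [Module R L]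
    [AddCommGroup M] [Module R M] {p : Q₀ →ₗ[R] M} (hp : IsProjectiveCover p) {ι : L →ₗ[R] Q₀}
    (hι : Function.Injective ι) (hιp : Function.Exact ι p) {p₁ : Q₁ →ₗ[R] L}
    (hp₁ : IsProjectiveCover p₁) {q : Q₂ →ₗ[R] LinearMap.ker p₁} (hq : IsProjectiveCover q) :
    IsMinPres ((LinearMap.ker p₁).subtype ∘ₗ q) (ι ∘ₗ p₁) p where
  finite₂ := hq.finite
  finite₁ := hp₁.finite
  finite₀ := hp.finite
  projective₂ := hq.projective
  projective₁ := hp₁.projective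
  projective₀ := hp.projective
  exact₁ y := by
    constructor
    · intro hy
      have hy' : p₁ y = 0 := hι (hy.trans (map_zero ι).symm)
      obtain ⟨x, hx⟩ := hq.surjective ⟨y, hy'⟩
      exact ⟨x, congrArg Subtype.val hx⟩
    · rintro ⟨x, rfl⟩
      exact (congrArg ι (q x).2).trans (map_zero ι)
  exact₀ y := by
    rw [hιp y]
    constructor
    · rintro ⟨l, rfl⟩
      obtain ⟨x, rfl⟩ := hp₁.surjective l
      exact ⟨x, rfl⟩
    · rintro ⟨x, rfl⟩
      exact ⟨p₁ x, rfl⟩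
  surjective := hp.surjective
  superfluous₂ := by
    rw [LinearMap.ker_comp_of_ker_eq_bot _ (LinearMap.ker p₁).ker_subtype]
    exact hq.superfluous
  superfluous₁ := by
    rw [LinearMap.ker_comp_of_ker_eq_bot _ (LinearMap.ker_eq_bot.2 hι)]
    exact hp₁.superfluous
  superfluous₀ := hp.superfluous

/-- `Tr Ω M` is computed by a minimal presentation of length two. -/
theorem exists_isMinPres {M L : ModuleCat.{u} R} {U : ModuleCat.{u} Rᵐᵒᵖ}
    (hL : IsNthSyzygy 1 M L) (hU : IsTranspose L U) :
    ∃ (Q₂ Q₁ Q₀ : ModuleCat.{u} R) (d₂ : Q₂ →ₗ[R] Q₁) (d₁ : Q₁ →ₗ[R] Q₀) (p : Q₀ →ₗ[R] M),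
      IsMinPres d₂ d₁ p ∧ Nonempty (U ≃ₗ[Rᵐᵒᵖ] TrCoker d₂) := by
  obtain ⟨M', ⟨e⟩, Q₀, p, hp, ⟨e'⟩⟩ := hL
  obtain ⟨Q₂, Q₁, p₁, q, hp₁, hq, hU⟩ := hU
  refine ⟨Q₂, Q₁, Q₀, _, _, _, isMinPres_of_isProjectiveCover (hp.comp_equiv e)
    (ι := (LinearMap.ker p).subtype ∘ₗ (e' : L →ₗ[R] LinearMap.ker p))
    ((LinearMap.ker p).injective_subtype.comp e'.injective) ?_ hp₁ hq, hU⟩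
  intro y
  constructor
  · intro hy
    exact ⟨e'.symm ⟨y, e.injective (hy.trans (map_zero e).symm)⟩, by simp⟩
  · rintro ⟨x, rfl⟩
    exact (congrArg e (e' x).2).trans (map_zero e)

/-- `Tr D Ω⁻¹ N` is computed by a minimal presentation of `D N` that begins with the dual of an
injective envelope of `N`. -/
theorem exists_isMinPres_dual {K : Type u} [Field K] [Algebra K R] [Module.Finite K R]
    {N L : ModuleCat.{u} R} {U : ModuleCat.{u} Rᵐᵒᵖᵐᵒᵖ}
    (hL : IsNthCosyzygy 1 N L) (hU : IsTranspose (dual K L) U) :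
    ∃ (J : ModuleCat.{u} R) (j : N →ₗ[R] J) (c : J →ₗ[R] L) (Q₂ Q₁ : ModuleCat.{u} Rᵐᵒᵖ)
      (d₂ : Q₂ →ₗ[Rᵐᵒᵖ] Q₁) (d₁ : Q₁ →ₗ[Rᵐᵒᵖ] dual K J),
      IsInjectiveEnvelope j ∧ Function.Surjective c ∧ Function.Exact j c ∧
        IsMinPres d₂ d₁ (dualMap (K := K) j) ∧ Nonempty (U ≃ₗ[Rᵐᵒᵖᵐᵒᵖ] TrCoker d₂) := by
  obtain ⟨N', ⟨e⟩, J, j, hj, ⟨e'⟩⟩ := hL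
  obtain ⟨Q₂, Q₁, p₁, q, hp₁, hq, hU⟩ := hU
  let c : J →ₗ[R] L := (e'.symm : _ →ₗ[R] L) ∘ₗ (LinearMap.range j).mkQ
  have hj' := hj.comp_equiv e.symm
  have hc : Function.Surjective c := e'.symm.surjective.comp (Submodule.mkQ_surjective _)
  have hjc : Function.Exact (j ∘ₗ (e.symm : N →ₗ[R] N')) c := by
    intro y
    constructor
    · intro hy
      have hy' : (LinearMap.range j).mkQ y = 0 := e'.symm.injective (hy.trans (map_zero _).symm)
      obtain ⟨x, rfl⟩ := (Submodule.Quotient.mk_eq_zero _).1 hy'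
      exact ⟨e x, by simp⟩
    · rintro ⟨x, rfl⟩
      have : (LinearMap.range j).mkQ (j (e.symm x)) = 0 :=
        (Submodule.Quotient.mk_eq_zero _).2 ⟨_, rfl⟩
      exact (congrArg e'.symm this).trans (map_zero _)
  exact ⟨J, _, c, Q₂, Q₁, _, _, hj', hc, hjc, isMinPres_of_isProjectiveCover
    (hj'.isProjectiveCover_dualMap (K := K)) (dualMap_injective hc) (dualMap_exact hc hjc) hp₁ hq,
    hU⟩

theorem exists_isTranspose [IsArtinianRing R] [IsNoetherianRing R] (L : ModuleCat.{u} R)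
    [Module.Finite R L] : ∃ U, IsTranspose L U := by
  obtain ⟨P₀, p, hp⟩ := exists_isProjectiveCover (R := R) L
  have := hp.finite
  obtain ⟨P₁, q, hq⟩ := exists_isProjectiveCover (R := R) (LinearMap.ker p)
  exact ⟨ModuleCat.of Rᵐᵒᵖ (TrCoker ((LinearMap.ker p).subtype ∘ₗ q)), P₁, P₀, p, q, hp, hq,
    ⟨LinearEquiv.refl _ _⟩⟩

variable (K : Type u) [Field K] [Algebra K R] [Module.Finite K R] (N : ModuleCat.{u} R)
  [Module.Finite R N]

theorem exists_isTau : ∃ T, IsTau K 2 N T := by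
  have := IsArtinianRing.of_finite K R
  have : IsNoetherianRing R := IsNoetherianRing.of_finite K R
  obtain ⟨P, p, hp⟩ := exists_isProjectiveCover (R := R) N
  have := hp.finite
  have : Module.Finite R (ModuleCat.of R (LinearMap.ker p)) :=
    inferInstanceAs (Module.Finite R (LinearMap.ker p))
  obtain ⟨U, hU⟩ := exists_isTranspose (ModuleCat.of R (LinearMap.ker p))
  exact ⟨_, _, U, ⟨N, ⟨LinearEquiv.refl _ _⟩, P, p, hp, ⟨LinearEquiv.refl _ _⟩⟩, hU,
    ⟨LinearEquiv.refl _ _⟩⟩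

theorem exists_isTauInv : ∃ T, IsTauInv K 2 N T := by
  have := IsArtinianRing.of_finite K Rᵐᵒᵖ
  have : IsNoetherianRing Rᵐᵒᵖ := IsNoetherianRing.of_finite K Rᵐᵒᵖ
  obtain ⟨I, j, hj⟩ := exists_isInjectiveEnvelope K N
  have := hj.finite
  let L := ModuleCat.of R (I ⧸ LinearMap.range j)
  have : Module.Finite R L := inferInstanceAs (Module.Finite R (I ⧸ LinearMap.range j))
  have := finite_of_finite (K := K) L
  have := finite_dual (K := K) L
  obtain ⟨U, hU⟩ := exists_isTranspose (dual K L)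
  exact ⟨_, L, U, ⟨N, ⟨LinearEquiv.refl _ _⟩, I, j, hj, ⟨LinearEquiv.refl _ _⟩⟩, hU,
    ⟨LinearEquiv.refl _ _⟩⟩

end Unpack

/-! ### Precluster tilting modules over the quotient -/

section Main

variable {R S : Type u} [Ring R] [Ring S] {f : R →+* S}

/-- If `Tor₁(S, M) = 0` and `X ∈ add (S ⊗ M)`, then `Tr Ω X` over `S` lies in the additive closure of
the reduction of `Tr Ω M` over `R`. -/
theorem IsMinPres.exists_inAdd_trCoker [IsNoetherianRing S] (hf : Function.Surjective f)
    {Q₂ Q₁ Q₀ M N P₂ P₁ P₀ X : Type u} [AddCommGroup Q₂] [Module R Q₂] [AddCommGroup Q₁]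
    [Module R Q₁] [AddCommGroup Q₀] [Module R Q₀] [AddCommGroup M] [Module R M]
    [AddCommGroup N] [Module S N] [AddCommGroup P₂] [Module S P₂] [AddCommGroup P₁]
    [Module S P₁] [AddCommGroup P₀] [Module S P₀] [AddCommGroup X] [Module S X]
    {d₂ : Q₂ →ₗ[R] Q₁} {d₁ : Q₁ →ₗ[R] Q₀} {p : Q₀ →ₗ[R] M}
    {c₂ : P₂ →ₗ[S] P₁} {c₁ : P₁ →ₗ[S] P₀} {q : P₀ →ₗ[S] X}
    (hP : IsMinPres c₂ c₁ q) (hQ : IsPres d₂ d₁ p) {π : M →ₛₗ[f] N} (hπ : IsReduction π)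
    (hTor : ∀ x, p x = 0 → x ∈ (RingHom.ker f • ⊤ : Submodule R Q₀) →
      x ∈ RingHom.ker f • LinearMap.ker p) (hX : InAdd S X N) :
    ∃ (W : ModuleCat.{u} Sᵐᵒᵖ) (ρ : TrCoker d₂ →ₛₗ[f.op] W),
      IsReduction ρ ∧ InAdd Sᵐᵒᵖ (TrCoker c₂) W := by
  obtain ⟨_, _, _, d₂', d₁', p', hQ', ρ, hρ⟩ := hQ.exists_reduction hf hπ hTor
  exact ⟨ModuleCat.of Sᵐᵒᵖ (TrCoker d₂'), ρ, hρ, hP.inAdd_trCoker hQ' hX⟩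

variable {K : Type u} [Field K] [Algebra K R] [Algebra K S] [Module.Finite K S]
  {M : ModuleCat.{u} R}

/-- `τ₂` over `S` of a module in `add (S ⊗ M)` is a summand of a direct sum of copies of
`Hom_R(S, τ₂ M)`. -/
theorem IsPreclusterTilting.inAdd_of_isTau (hM : IsPreclusterTilting K 2 M)
    (hf : Function.Surjective f) (hK : ∀ k, f (algebraMap K R k) = algebraMap K S k)
    (hHom : ∀ X : ModuleCat.{u} R, InAdd R X M →
      InAdd R ((ModuleCat.restrictScalars f).obj ((ModuleCat.coextendScalars f).obj X)) M)
    {X T : ModuleCat.{u} S} (hX : InAdd S X (tensorObj f M)) (hT : IsTau K 2 X T) :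
    InAdd R ((ModuleCat.restrictScalars f).obj T) M := by
  have : IsNoetherianRing S := IsNoetherianRing.of_finite K S
  obtain ⟨L, V, hL, hV, ⟨eT⟩⟩ := hT
  obtain ⟨P₂, P₁, P₀, c₂, c₁, q, hP, ⟨eV⟩⟩ := exists_isMinPres hL hV
  obtain ⟨T', hT'⟩ := hM.exists_tau
  have hT'M := addClosure_iff_inAdd.1 (hM.tau_mem T' hT')
  obtain ⟨L', U, hL', hU, ⟨eT'⟩⟩ := hT'
  obtain ⟨Q₂, Q₁, Q₀, d₂, d₁, p, hQ, ⟨eU⟩⟩ := exists_isMinPres hL' hU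
  obtain ⟨π, hπ⟩ := exists_isReduction_tensorObj hf M
  have hDR := addClosure_iff_inAdd.1 hM.cogenerator
  obtain ⟨ιD, hιD⟩ := exists_isCoreduction_dualRegular hf hK
  have hExt := subsingleton_ext_of_inAdd (hM.ext_eq_zero 1 one_pos one_lt_two)
    (InAdd.of_equiv (LinearEquiv.refl R M)) (hιD.inAdd_restrictScalars hf (hHom _ hDR))
  have hTor := mem_smul_ker_of_forall_extend hf hK p fun g => by
    obtain ⟨G, hG⟩ := exists_extend_of_ext (A := ModuleCat.of R (LinearMap.ker p)) hExt
      (LinearMap.ker p).injective_subtype (p := p) (fun y => by simp) hQ.surjective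
      { toFun := fun y => g y, map_add' := map_add g, map_smul' := fun r y => g.map_smulₛₗ r y }
    exact ⟨{ toFun := fun y => G y, map_add' := map_add G, map_smul' := fun r y => G.map_smul r y },
      hG⟩
  obtain ⟨W, ρ, hρ, hW⟩ := hP.exists_inAdd_trCoker hf hQ.toIsPres hπ hTor hX
  obtain ⟨ι, -, hι⟩ := (hρ.comp_equiv eU).exists_dual_isCoreduction (K := K) (U := U)
    fun k => congrArg MulOpposite.op (hK k)
  obtain ⟨ι', hι'⟩ := hι.ofOpOp
  have hTW : InAdd S T (ofOpOp (dual K W)) :=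
    (InAdd.of_equiv eT).trans ((InAdd.of_equiv eV).trans hW).dual.ofOpOp
  refine (hTW.restrictScalars f).trans (hι'.inAdd_restrictScalars hf (hHom _ ?_))
  exact (InAdd.of_equiv eT'.symm).trans hT'M

/-- `τ₂⁻` over `S` of a module in `add Hom_R(S, M)` is a summand of a direct sum of copies of
`S ⊗ τ₂⁻ M`. -/
theorem IsPreclusterTilting.inAdd_of_isTauInv [Module.Finite K R] (hM : IsPreclusterTilting K 2 M)
    (hf : Function.Surjective f) (hK : ∀ k, f (algebraMap K R k) = algebraMap K S k)
    (hTensor : ∀ X : ModuleCat.{u} R, InAdd R X M →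
      InAdd R ((ModuleCat.restrictScalars f).obj (tensorObj f X)) M)
    {X T : ModuleCat.{u} S} (hX : InAdd S X ((ModuleCat.coextendScalars f).obj M))
    (hT : IsTauInv K 2 X T) : InAdd R ((ModuleCat.restrictScalars f).obj T) M := by
  have : IsNoetherianRing Sᵐᵒᵖ := IsNoetherianRing.of_finite K Sᵐᵒᵖ
  have hf' : Function.Surjective f.op := fun s => by
    obtain ⟨r, hr⟩ := hf s.unop
    exact ⟨.op r, congrArg MulOpposite.op hr⟩
  have hK' : ∀ k, f.op (algebraMap K Rᵐᵒᵖ k) = algebraMap K Sᵐᵒᵖ k :=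
    fun k => congrArg MulOpposite.op (hK k)
  have := hM.finite
  have := finite_of_finite (K := K) M
  obtain ⟨L, V, hL, hV, ⟨eT⟩⟩ := hT
  obtain ⟨J', j', c', P₂, P₁, c₂, c₁, -, -, -, hP, ⟨eV⟩⟩ := exists_isMinPres_dual hL hV
  obtain ⟨T', hT'⟩ := hM.exists_tauInv
  have hT'M := addClosure_iff_inAdd.1 (hM.tauInv_mem T' hT')
  obtain ⟨L', U, hL', hU, ⟨eT'⟩⟩ := hT'
  obtain ⟨J, j, c, Q₂, Q₁, d₂, d₁, hj, hc, hjc, hQ, ⟨eU⟩⟩ := exists_isMinPres_dual hL' hU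
  have := hj.finite
  have := finite_of_finite (K := K) J
  obtain ⟨ι, hι⟩ := exists_isCoreduction_coextendScalars hf M
  obtain ⟨π, hπ⟩ := hι.exists_dual_isReduction hK
  have hRM := addClosure_iff_inAdd.1 hM.generator
  obtain ⟨πS, hπS⟩ := isReduction_self hf
  have hSM : InAdd R ((ModuleCat.restrictScalars f).obj (ModuleCat.of S S)) M :=
    IsReduction.inAdd_restrictScalars hf (U := ModuleCat.of R R) (W := ModuleCat.of S S) hπS
      (hTensor _ hRM)
  have hExt := subsingleton_ext_of_inAdd (hM.ext_eq_zero 1 one_pos one_lt_two) hSM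
    (InAdd.of_equiv (LinearEquiv.refl R M))
  have hTor := mem_smul_ker_dualMap (K := K) (f := f) hjc fun y hy => by
    obtain ⟨g, rfl⟩ := exists_linearMap_apply_one hf y hy
    obtain ⟨G, hG⟩ := exists_lift_of_ext hExt hj.injective hjc hc g
    let one : (ModuleCat.restrictScalars f).obj (ModuleCat.of S S) := (1 : S)
    refine ⟨G one, fun r hr => ?_, hG one⟩
    have : r • one = 0 := by
      change f r * 1 = 0
      rw [hr, zero_mul]
    rw [← map_smul, this, map_zero]
  obtain ⟨W, ρ, hρ, hW⟩ := hP.exists_inAdd_trCoker hf' hQ.toIsPres hπ hTor hX.dual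
  obtain ⟨ρ', hρ'⟩ := IsReduction.ofOpOp (M := U) (hρ.comp_equiv eU)
  have hTW : InAdd S T (ofOpOp W) :=
    (InAdd.of_equiv eT).trans ((InAdd.of_equiv eV).trans hW).ofOpOp
  refine (hTW.restrictScalars f).trans (hρ'.inAdd_restrictScalars hf (hTensor _ ?_))
  exact (InAdd.of_equiv eT'.symm).trans hT'M

/-- If `S ⊗ -` and `Hom_R(S, -)` preserve `add M` for a `2`-precluster tilting `R`-module `M`, then
`S ⊗ M` is `2`-precluster tilting over `S`. -/
theorem IsPreclusterTilting.tensorObj [Module.Finite K R] (hM : IsPreclusterTilting K 2 M)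
    (hf : Function.Surjective f) (hK : ∀ k, f (algebraMap K R k) = algebraMap K S k)
    (hHom : ∀ X : ModuleCat.{u} R, InAdd R X M →
      InAdd R ((ModuleCat.restrictScalars f).obj ((ModuleCat.coextendScalars f).obj X)) M)
    (hTensor : ∀ X : ModuleCat.{u} R, InAdd R X M →
      InAdd R ((ModuleCat.restrictScalars f).obj (tensorObj f X)) M) :
    IsPreclusterTilting K 2 (tensorObj f M) := by
  have hMM := InAdd.of_equiv (LinearEquiv.refl R M)
  have hN := hTensor M hMM
  obtain ⟨π, hπ⟩ := exists_isReduction_tensorObj hf M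
  obtain ⟨ι, hι⟩ := exists_isCoreduction_coextendScalars hf M
  have hmem : ∀ X : ModuleCat.{u} S, InAdd R ((ModuleCat.restrictScalars f).obj X) M →
      addClosure (Precluster.tensorObj f M) X := fun X hX =>
    addClosure_iff_inAdd.2 (hπ.inAdd hf hX)
  have := hM.finite
  have hfin : Module.Finite S (Precluster.tensorObj f M) :=
    finite_of_finite_restrictScalars hf _ hN.finite
  refine ⟨hfin, hmem _ ?_, hmem _ ?_, exists_isTau K _, fun T hT => hmem _ ?_,
    exists_isTauInv K _, fun T hT => hmem _ ?_, fun i hi0 hi2 => ?_⟩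
  · obtain ⟨πS, hπS⟩ := isReduction_self hf
    exact IsReduction.inAdd_restrictScalars hf (U := ModuleCat.of R R) (W := ModuleCat.of S S) hπS
      (hTensor _ (addClosure_iff_inAdd.1 hM.generator))
  · obtain ⟨ιD, hιD⟩ := exists_isCoreduction_dualRegular hf hK
    exact hιD.inAdd_restrictScalars hf (hHom _ (addClosure_iff_inAdd.1 hM.cogenerator))
  · exact hM.inAdd_of_isTau hf hK hHom (InAdd.of_equiv (LinearEquiv.refl S _)) hT
  · exact hM.inAdd_of_isTauInv hf hK hTensor (hι.inAdd hf hN) hT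
  · obtain rfl : i = 1 := by omega
    -- Extensions of `S`-modules are extensions of `R`-modules, and `R`-linear maps between
    -- `S`-modules are `S`-linear.
    refine subsingleton_ext_of_forall_extend fun A B i p hi hip hp g => ?_
    have hExt := subsingleton_ext_of_inAdd (hM.ext_eq_zero 1 one_pos one_lt_two) hN hN
    obtain ⟨G, hG⟩ := exists_extend_of_ext hExt
      (i := ((ModuleCat.restrictScalars f).map (ModuleCat.ofHom i)).hom)
      (p := ((ModuleCat.restrictScalars f).map (ModuleCat.ofHom p)).hom) hi hip hp
      ((ModuleCat.restrictScalars f).map (ModuleCat.ofHom g)).hom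
    exact ⟨linearOfSurjective hf (AddMonoidHom.mk' (fun x : B => G x) (map_add G))
      fun r x => G.map_smul r x, hG⟩

end Main

end Precluster

theorem theorem1p1 (K : Type u) [Field K] (A : Type u) [Ring A] [Algebra K A]
    [FiniteDimensional K A] (e : A) (he : IsIdempotentElem e)
    (Ctilde : CategoryTheory.ObjectProperty (ModuleCat.{u} A))
    (hC : Precluster.IsPreclusterTiltingSubcategory K 2 Ctilde)
    (hHom : ∀ X, Ctilde X → Ctilde (Precluster.homQuot e X))
    (hTensor : ∀ X, Ctilde X → Ctilde (Precluster.tensorQuot e X)) :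
    Precluster.IsPreclusterTiltingSubcategory K 2
      (Ctilde.inverseImage (Precluster.inclusion e)) := by
  obtain ⟨M, hM, rfl⟩ := hC
  let f : A →+* Precluster.QuotAlg e := Ideal.Quotient.mk (Precluster.idealOf e)
  have hf : Function.Surjective f := Ideal.Quotient.mk_surjective
  have : Module.Finite K (Precluster.QuotAlg e) :=
    Module.Finite.of_surjective (Ideal.Quotient.mkₐ K (Precluster.idealOf e)).toLinearMap hf
  have hTensor' : ∀ X : ModuleCat.{u} A, Precluster.InAdd A X M → Precluster.InAdd A
      ((ModuleCat.restrictScalars f).obj (Precluster.tensorObj f X)) M := fun X hX =>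
    Precluster.addClosure_iff_inAdd.1 (hTensor X (Precluster.addClosure_iff_inAdd.2 hX))
  refine ⟨Precluster.tensorObj f M, hM.tensorObj hf (fun k => rfl) (fun X hX =>
    Precluster.addClosure_iff_inAdd.1 (hHom X (Precluster.addClosure_iff_inAdd.2 hX))) hTensor', ?_⟩
  funext X
  refine propext (Iff.trans Precluster.addClosure_iff_inAdd (Iff.trans ⟨fun hX => ?_, fun hX => ?_⟩
    Precluster.addClosure_iff_inAdd.symm))
  · obtain ⟨π, hπ⟩ := Precluster.exists_isReduction_tensorObj hf M
    exact hπ.inAdd hf hX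
  · exact (hX.restrictScalars f).trans
      (hTensor' M (Precluster.InAdd.of_equiv (LinearEquiv.refl A M)))
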